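/- **Syntax.** Formulae and programs of PDL are built from countably infinite, disjoint sets of propositional atoms $p$ and atomic programs $a$ by $\varphi ::= p \mid \neg\varphi \mid \varphi\wedge\varphi \mid \varphi\vee\varphi \mid \langle\alpha\rangle\varphi \mid [\alpha]\varphi$ and $\alpha ::= a \mid \varphi? \mid \alpha;\alpha \mid \alpha\cup\alpha \mid \alpha^*$. A formula is in negation normal form if $\neg$ occurs only immediately before atoms; $\sim\!\psi$ is the negation normal form of $\neg\psi$. Let $\mathrm{pre}(\varphi)=\{\langle\alpha_1\rangle\cdots\langle\alpha_k\rangle\varphi : k\ge 0\}$. The relation $\rightsquigarrow$ is given by $\langle\alpha;\beta\rangle\chi\rightsquigarrow\langle\alpha\rangle\langle\beta\rangle\chi$; $\langle\alpha\cup\beta\rangle\chi\rightsquigarrow\langle\alpha\rangle\chi$ and $\rightsquigarrow\langle\beta\rangle\chi$; $\langle\alpha^*\rangle\chi\rightsquigarrow\chi$ and $\rightsquigarrow\langle\alpha\rangle\langle\alpha^*\rangle\chi$; $\langle\psi?\rangle\chi\rightsquigarrow\chi$. **Hintikka structures.** A structure $(W,R,L)$ has a non-empty set $W$, a relation $R_a\subseteq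 W\times W$ for each atomic program $a$, and a set $L(w)$ of formulae for each $w\in W$. It is a Hintikka structure for $\phi$ if $\phi\in L(v)$ for some $v\in W$ and, for all $w\in W$: (H1) $\neg p\in L(w)$ implies $p\notin L(w)$; (H2) if an $\boldsymbol\alpha$-formula is in $L(w)$ then so are all its components, where $\varphi\wedge\psi$ has components $\varphi,\psi$; $[\alpha\cup\beta]\varphi$ has $[\alpha]\varphi,[\beta]\varphi$; $[\alpha^*]\varphi$ has $\varphi,[\alpha][\alpha^*]\varphi$; $\langle\psi?\rangle\varphi$ has $\varphi,\psi$; $\langle\alpha;\beta\rangle\varphi$ has $\langle\alpha\rangle\langle\beta\rangle\varphi$; $[\alpha;\beta]\varphi$ has $[\alpha][\beta]\varphi$; (H3) if a $\boldsymbol\beta$-formula is in $L(w)$ then so is one of its components, where $\varphi\vee\psi$ has components $\varphi,\psi$; $\langle\alpha\cup\beta\rangle\varphi$ has $\langle\alpha\rangle\varphi,\langle\beta\rangle\varphi$; $\langle\alpha^*\rangle\varphi$ has $\varphi,\langle\alpha\rangle\langle\alpha^*\rangle\varphi$; $[\psi?]\varphi$ has $\varphi,\sim\!\psi$; (H4)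 $\langle a\rangle\varphi\in L(w)$ implies $\varphi\in L(v)$ for some $v$ with $w\,R_a\,v$; (H5) $[a]\varphi\in L(w)$ and $w\,R_a\,v$ imply $\varphi\in L(v)$; (H6) $\langle\alpha^*\rangle\varphi\in L(w)$ implies that there is a finite sequence $(w_0,\psi_0),\dots,(w_n,\psi_n)$ with $w_i\in W$, $\psi_i\in\mathrm{pre}(\varphi)\cap L(w_i)$, $w_0=w$, $\psi_0=\langle\alpha^*\rangle\varphi$, $\psi_n=\varphi$, $\psi_i\ne\varphi$ for $i<n$, such that for each $i<n$: if $\psi_i=\langle a\rangle\chi$ with $a$ atomic, then $\psi_{i+1}=\chi$ and $w_i\,R_a\,w_{i+1}$; otherwise $\psi_i\rightsquigarrow\psi_{i+1}$ and $w_i=w_{i+1}$. **Tableaux.** A node $\Gamma::\mathrm{HCr},\mathrm{Nx},\mathrm{BD},\mathrm{BB}::\mathrm{stat},\mathrm{uev}$ consists of a set $\Gamma$ of formulae, a list $\mathrm{HCr}$ of pairs $(\varphi,\Delta)$ with $\varphi\in\Delta$, a formula or $\bot$ as $\mathrm{Nx}$, sets $\mathrm{BD},\mathrm{BB}$ of formulae,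 $\mathrm{stat}\in\{\mathbf{unsat},\mathbf{open},\mathbf{barred}\}$, and a partial function $\mathrm{uev}$ from pairs (formula $\langle\alpha\rangle\varphi$, formula $\langle\alpha^*\rangle\varphi$) to the positive integers; $\bot$ denotes undefinedness. Call $\langle\alpha\rangle\varphi$ with $\alpha$ not atomic *complex*; put $\mathrm{tst}(\chi)=\chi$, $\mathrm{bl}(\chi,S)=S$ if $\chi$ is complex, and $\mathrm{tst}(\chi)=\bot$, $\mathrm{bl}(\chi,S)=\emptyset$ otherwise. The rules act on a node as follows. Except in the last rule, $\pi$ is the principal formula and $\Gamma$ the set of the *other* formulae of the node; anything not mentioned is copied unchanged; a subscript $i$ refers to the $i$-th child (no subscript $i$ if there is only one). "Free" means $\mathrm{Nx}=\bot$; "designated" means $\mathrm{Nx}\in\{\bot,\pi\}$. 1. *Terminal.* If the node contains $p$ and $\neg p$: no child, $\mathrm{stat}=\mathbf{unsat}$, $\mathrm{uev}$ nowhere defined. If $\pi=\langle\alpha^*\rangle\varphi\in\mathrm{BD}$ is designated: no child, $\mathrm{stat}=\mathbf{barred}$, $\mathrm{uev}$ nowhere defined. 2. *Linear, non-diamond*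 ($\pi$ free). $\pi=\varphi\wedge\psi$, $[\alpha\cup\beta]\varphi$, $[\alpha;\beta]\varphi$: one child in which $\pi$ is replaced by its components. $\pi=[\alpha^*]\varphi$: one child with formulae $\Gamma$ if $\pi\in\mathrm{BB}$ and $\Gamma\cup\{\varphi,[\alpha][\alpha^*]\varphi\}$ otherwise, and with $\pi$ added to $\mathrm{BB}$. $\mathrm{uev}(\chi_1,\chi_2)$ is that of the child if $\chi_1\in\Gamma$, else $\bot$. 3. *Linear, diamond* ($\pi$ designated). $\pi=\langle\alpha;\beta\rangle\varphi$, with reduct $\rho=\langle\alpha\rangle\langle\beta\rangle\varphi$: child formulae $\Gamma\cup\{\rho\}$. $\pi=\langle\psi?\rangle\varphi$, with reduct $\rho=\varphi$: child formulae $\Gamma\cup\{\psi,\varphi\}$. The child has $\mathrm{Nx}=\mathrm{tst}(\rho)$ and $\mathrm{BD}$ replaced by $\mathrm{bl}(\rho,\mathrm{BD})$. $\mathrm{uev}(\pi,\chi_2)$ is the child's value at $(\rho,\chi_2)$; $\mathrm{uev}(\chi_1,\chi_2)$ is the child's value if $\chi_1\in\Gamma$; else $\bot$. 4. *Branching, non-diamond*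 ($\pi$ free). $\pi=\varphi_1\vee\varphi_2$: children $\Gamma\cup\{\varphi_1\}$ and $\Gamma\cup\{\varphi_2\}$. $\pi=[\psi?]\varphi$: children $\Gamma\cup\{\sim\!\psi\}$ and $\Gamma\cup\{\varphi\}$. Let $\mathrm{uev}_i'$ be $\mathrm{uev}_i$ restricted to $\chi_1\in\Gamma$. 5. *Branching, diamond* ($\pi$ designated). $\pi=\langle\alpha_1\cup\alpha_2\rangle\varphi$: reducts $\rho_i=\langle\alpha_i\rangle\varphi$, $B=\mathrm{BD}$. $\pi=\langle\alpha^*\rangle\varphi\notin\mathrm{BD}$: reducts $\rho_1=\varphi$, $\rho_2=\langle\alpha\rangle\langle\alpha^*\rangle\varphi$, $B=\mathrm{BD}\cup\{\pi\}$. Child $i$ has formulae $\Gamma\cup\{\rho_i\}$, $\mathrm{Nx}=\mathrm{tst}(\rho_i)$, $\mathrm{BD}=\mathrm{bl}(\rho_i,B)$. $\mathrm{uev}_i'(\pi,\chi_2)=\mathrm{uev}_i(\rho_i,\chi_2)$, $\mathrm{uev}_i'(\chi_1,\chi_2)=\mathrm{uev}_i(\chi_1,\chi_2)$ if $\chi_1\in\Gamma$,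 else $\bot$; except that $\mathrm{uev}_1'(\pi,\pi)=\bot$ if $\pi=\langle\alpha^*\rangle\varphi$. In 4 and 5: $\mathrm{stat}=\mathbf{unsat}$ if both children are $\mathbf{unsat}$, $\mathbf{open}$ if some child is $\mathbf{open}$, $\mathbf{barred}$ otherwise. If both children are open, $\mathrm{uev}$ is the pointwise minimum of $\mathrm{uev}_1',\mathrm{uev}_2'$ where both are defined and $\bot$ elsewhere; if only child $i$ is open, $\mathrm{uev}=\mathrm{uev}_i'$; if none is, $\mathrm{uev}$ is nowhere defined. 6. *Existential.* Applicable if the formula set $\Gamma$ of the node contains only formulae $p$, $\neg p$, $\langle a\rangle\varphi$, $[a]\varphi$ with $a$ atomic, and never both $p$ and $\neg p$. For $\langle a\rangle\varphi\in\Gamma$ let $\Delta_a=\{\psi:[a]\psi\in\Gamma\}$; it is *blocked* if $(\varphi,\{\varphi\}\cup\Delta_a)$ is in $\mathrm{HCr}$. Let $\langle a_1\rangle\varphi_1,\dots,\langle a_n\rangle\varphi_n$ ($n\ge0$) be the distinct unblocked diamonds. There are $n$ children; child $i$ has formulae $\{\varphi_i\}\cup\Delta_{a_i}$, $\mathrm{HCr}$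 extended at its end by $(\varphi_i,\{\varphi_i\}\cup\Delta_{a_i})$, $\mathrm{Nx}=\mathrm{tst}(\varphi_i)$, $\mathrm{BD}=\mathrm{BB}=\emptyset$. $\mathrm{stat}=\mathbf{unsat}$ if some child is not open, or if for some $i$ and some $\psi$ of the form $\langle\alpha^*\rangle\chi$ with $\varphi_i\in\mathrm{pre}(\psi)$ the value $\mathrm{uev}_i(\varphi_i,\psi)$ is defined and greater than the length of $\mathrm{HCr}$; otherwise $\mathrm{stat}=\mathbf{open}$. If $\mathrm{stat}=\mathbf{open}$, $\chi_2$ is of the form $\langle\alpha^*\rangle\chi$ and $\chi_1\in\Gamma\cap\mathrm{pre}(\chi_2)$ is a diamond, then $\mathrm{uev}(\chi_1,\chi_2)=\mathrm{uev}_i(\varphi_i,\chi_2)$ if $\chi_1=\langle a_i\rangle\varphi_i$ is unblocked, and $\mathrm{uev}(\chi_1,\chi_2)=j$ if $\chi_1=\langle a\rangle\varphi$ is blocked and $(\varphi,\{\varphi\}\cup\Delta_a)$ is the $j$-th entry of $\mathrm{HCr}$; otherwise $\mathrm{uev}(\chi_1,\chi_2)=\bot$. A *tableau* is a rooted tree of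 nodes (not assumed to be finite) in which the children of each node that has children arise by one application of a rule to that node, with the $\mathrm{stat}$ and $\mathrm{uev}$ of the node determined by those of its children. It is *expanded* if no rule remains to be applied to a leaf, that is, at each leaf either a rule without children has been applied, which determines $\mathrm{stat}$ and $\mathrm{uev}$, or no rule is applicable. **Theorem (soundness).** Let $\phi$ be a formula in negation normal form and let $T$ be an expanded tableau whose root has the form $\{\phi\}::[\,],\bot,\emptyset,\emptyset::\mathrm{stat},\mathrm{uev}$. If the root is open, i.e. $\mathrm{stat}=\mathbf{open}$, then there is a Hintikka structure for $\phi$. -/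

import Mathlib

namespace PDL

/-! ### Formulae and programs

Propositional atoms and atomic programs are both indexed by `ℕ`; they are kept
disjoint by the two different constructors `Fml.atom` and `Prg.atom`. -/

mutual
/-- Formulae of propositional dynamic logic. -/
inductive Fml : Type
  | atom : ℕ → Fml
  | neg : Fml → Fml
  | and : Fml → Fml → Fml
  | or : Fml → Fml → Fml
  | dia : Prg → Fml → Fml
  | box : Prg → Fml → Fml
/-- Programs of propositional dynamic logic. -/
inductive Prg : Type
  | atom : ℕ → Prg
  | test : Fml → Prg
  | seq : Prg → Prg → Prg
  | union : Prg → Prg → Prg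
  | star : Prg → Prg
end

/-- The formulae `⟨α⟩φ`. -/
def FmlDia : Set Fml := {χ | ∃ α φ, χ = Fml.dia α φ}

/-- The formulae `⟨α⟩φ` whose outermost program `α` is not atomic. -/
def FmlDiaNonatomic : Set Fml := {χ | ∃ α φ, χ = Fml.dia α φ ∧ ∀ a, α ≠ Prg.atom a}

/-- The formulae `⟨α*⟩φ`. -/
def FmlDiaStar : Set Fml := {χ | ∃ α φ, χ = Fml.dia (Prg.star α) φ}

/-! ### Negation normal form -/

mutual
/-- Negation appears only immediately in front of propositional atoms
(also inside the tests of programs). -/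
def Fml.IsNNF : Fml → Prop
  | .atom _ => True
  | .neg (.atom _) => True
  | .neg _ => False
  | .and φ ψ => φ.IsNNF ∧ ψ.IsNNF
  | .or φ ψ => φ.IsNNF ∧ ψ.IsNNF
  | .dia α φ => α.IsNNF ∧ φ.IsNNF
  | .box α φ => α.IsNNF ∧ φ.IsNNF
/-- All tests of the program are in negation normal form. -/
def Prg.IsNNF : Prg → Prop
  | .atom _ => True
  | .test φ => φ.IsNNF
  | .seq α β => α.IsNNF ∧ β.IsNNF
  | .union α β => α.IsNNF ∧ β.IsNNF
  | .star α => α.IsNNF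
end

mutual
/-- `Fml.nnfAux true φ` is the negation normal form of `φ`,
`Fml.nnfAux false φ` that of the negation of `φ`. -/
def Fml.nnfAux : Bool → Fml → Fml
  | true, .atom p => .atom p
  | false, .atom p => .neg (.atom p)
  | b, .neg φ => Fml.nnfAux (!b) φ
  | true, .and φ ψ => .and (Fml.nnfAux true φ) (Fml.nnfAux true ψ)
  | false, .and φ ψ => .or (Fml.nnfAux false φ) (Fml.nnfAux false ψ)
  | true, .or φ ψ => .or (Fml.nnfAux true φ) (Fml.nnfAux true ψ)
  | false, .or φ ψ => .and (Fml.nnfAux false φ) (Fml.nnfAux false ψ)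
  | true, .dia α φ => .dia (Prg.nnf α) (Fml.nnfAux true φ)
  | false, .dia α φ => .box (Prg.nnf α) (Fml.nnfAux false φ)
  | true, .box α φ => .box (Prg.nnf α) (Fml.nnfAux true φ)
  | false, .box α φ => .dia (Prg.nnf α) (Fml.nnfAux false φ)
/-- Replace every test by its negation normal form. -/
def Prg.nnf : Prg → Prg
  | .atom a => .atom a
  | .test φ => .test (Fml.nnfAux true φ)
  | .seq α β => .seq (Prg.nnf α) (Prg.nnf β)
  | .union α β => .union (Prg.nnf α) (Prg.nnf β)
  | .star α => .star (Prg.nnf α)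
end

/-- The negation normal form of `φ`. -/
def Fml.nnf (φ : Fml) : Fml := Fml.nnfAux true φ

/-- `∼φ`, the negation normal form of `¬φ`. -/
def Fml.negNNF (φ : Fml) : Fml := (Fml.neg φ).nnf

/-! ### Hintikka structures -/

/-- `Alpha χ S`: `χ` is an α-formula and `S` is the set of its one or two components. -/
inductive Alpha : Fml → Set Fml → Prop
  | and (φ ψ : Fml) : Alpha (.and φ ψ) {φ, ψ}
  | boxUnion (α β : Prg) (φ : Fml) : Alpha (.box (.union α β) φ) {.box α φ, .box β φ}
  | boxStar (α : Prg) (φ : Fml) :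
      Alpha (.box (.star α) φ) {φ, .box α (.box (.star α) φ)}
  | diaTest (ψ φ : Fml) : Alpha (.dia (.test ψ) φ) {φ, ψ}
  | diaSeq (α β : Prg) (φ : Fml) : Alpha (.dia (.seq α β) φ) {.dia α (.dia β φ)}
  | boxSeq (α β : Prg) (φ : Fml) : Alpha (.box (.seq α β) φ) {.box α (.box β φ)}

/-- `Beta χ χ₁ χ₂`: `χ` is a β-formula with components `χ₁` and `χ₂`. -/
inductive Beta : Fml → Fml → Fml → Prop
  | or (φ ψ : Fml) : Beta (.or φ ψ) φ ψ
  | diaUnion (α β : Prg) (φ : Fml) : Beta (.dia (.union α β) φ) (.dia α φ) (.dia β φ)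
  | diaStar (α : Prg) (φ : Fml) :
      Beta (.dia (.star α) φ) φ (.dia α (.dia (.star α) φ))
  | boxTest (ψ φ : Fml) : Beta (.box (.test ψ) φ) φ ψ.negNNF

/-- `pre φ` is the set of all `⟨α₁⟩ … ⟨αₖ⟩φ` with `k ≥ 0`. -/
def pre (φ : Fml) : Set Fml := {ψ | ∃ l : List Prg, ψ = l.foldr Fml.dia φ}

/-- The relation `φ ⇝ ψ` of one reduction step of a diamond with non-atomic program. -/
inductive Reduces : Fml → Fml → Prop
  | seq (α β : Prg) (χ : Fml) : Reduces (.dia (.seq α β) χ) (.dia α (.dia β χ))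
  | unionLeft (α β : Prg) (χ : Fml) : Reduces (.dia (.union α β) χ) (.dia α χ)
  | unionRight (α β : Prg) (χ : Fml) : Reduces (.dia (.union α β) χ) (.dia β χ)
  | starStop (α : Prg) (χ : Fml) : Reduces (.dia (.star α) χ) χ
  | starStep (α : Prg) (χ : Fml) :
      Reduces (.dia (.star α) χ) (.dia α (.dia (.star α) χ))
  | test (φ χ : Fml) : Reduces (.dia (.test φ) χ) χ

/-- A labelled transition frame with set of worlds `W`. -/
structure LStruct (W : Type) where
  nonempty : Nonempty W
  R : ℕ → W → W → Prop
  L : W → Set Fml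

/-- `(w 0, ψ 0), …, (w n, ψ n)` is a fulfilling chain for `(φ, β, w₀)`. The values of the
two sequences at arguments larger than `n` are irrelevant. -/
structure LStruct.IsFulfillingChain {W : Type} (H : LStruct W) (φ : Fml) (β : Prg) (w₀ : W)
    (n : ℕ) (w : ℕ → W) (ψ : ℕ → Fml) : Prop where
  mem_pre : ∀ i ≤ n, ψ i ∈ pre φ
  mem_label : ∀ i ≤ n, ψ i ∈ H.L (w i)
  world_zero : w 0 = w₀
  fml_zero : ψ 0 = .dia β φ
  fml_last : ψ n = φ
  fml_ne : ∀ i < n, ψ i ≠ φ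
  step_atom : ∀ i < n, ∀ a χ, ψ i = .dia (.atom a) χ →
    ψ (i + 1) = χ ∧ H.R a (w i) (w (i + 1))
  step_reduce : ∀ i < n, (¬ ∃ a χ, ψ i = .dia (.atom a) χ) →
    Reduces (ψ i) (ψ (i + 1)) ∧ w i = w (i + 1)

/-- Conditions H1 to H5. -/
structure LStruct.IsPreHintikka {W : Type} (H : LStruct W) : Prop where
  h1 : ∀ w p, Fml.neg (.atom p) ∈ H.L w → Fml.atom p ∉ H.L w
  h2 : ∀ w χ S, Alpha χ S → χ ∈ H.L w → S ⊆ H.L w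
  h3 : ∀ w χ χ₁ χ₂, Beta χ χ₁ χ₂ → χ ∈ H.L w → χ₁ ∈ H.L w ∨ χ₂ ∈ H.L w
  h4 : ∀ w a φ, Fml.dia (.atom a) φ ∈ H.L w → ∃ v, H.R a w v ∧ φ ∈ H.L v
  h5 : ∀ w a φ, Fml.box (.atom a) φ ∈ H.L w → ∀ v, H.R a w v → φ ∈ H.L v

/-- Conditions H1 to H6. -/
structure LStruct.IsHintikka {W : Type} (H : LStruct W) : Prop extends H.IsPreHintikka where
  h6 : ∀ w α φ, Fml.dia (.star α) φ ∈ H.L w →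
    ∃ n v ψ, H.IsFulfillingChain φ (.star α) w n v ψ

/-- A Hintikka structure for `φ`: moreover some world is labelled with `φ`. -/
def LStruct.IsHintikkaFor {W : Type} (H : LStruct W) (φ : Fml) : Prop :=
  H.IsHintikka ∧ ∃ v, φ ∈ H.L v

/-! ### Tableau nodes

A node `Γ :: HCr, Nx, BD, BB :: stat, uev` is split into the part that is passed from parents
to children and the part that is passed from children to parents. -/

/-- The status of a node; `opened` stands for the value "open". -/
inductive Status : Type
  | unsat
  | opened
  | barred

/-- The value `none` stands for "undefined". -/
abbrev Uev : Type := Fml → Fml → Option ℕ+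

/-- The formula set and the histories of a node; `Nx = none` stands for `Nx = ⊥`. -/
structure Sequent : Type where
  Γ : Set Fml
  HCr : List (Fml × Set Fml)
  Nx : Option Fml
  BD : Set Fml
  BB : Set Fml

/-- The variables of a node. -/
structure Vars : Type where
  stat : Status
  uev : Uev

structure Node : Type where
  seq : Sequent
  vars : Vars

/-- The entries `(φ, Δ)` of `HCr` satisfy `φ ∈ Δ`, and `uev` is a partial function on
pairs of a diamond formula and a starred diamond formula. -/
structure Node.WellFormed (x : Node) : Prop where
  hcr : ∀ e ∈ x.seq.HCr, e.1 ∈ e.2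
  uev : ∀ χ₁ χ₂, x.vars.uev χ₁ χ₂ ≠ none → χ₁ ∈ FmlDia ∧ χ₂ ∈ FmlDiaStar

/-- The nowhere defined `uev`. -/
def uevBot : Uev := fun _ _ => none

open Classical in
noncomputable def tst (χ : Fml) : Option Fml :=
  if χ ∈ FmlDiaNonatomic then some χ else none

open Classical in
noncomputable def bl (χ : Fml) (S : Set Fml) : Set Fml :=
  if χ ∈ FmlDiaNonatomic then S else ∅

open Classical in
/-- Restriction of `uev` to first arguments in `Γ`. -/
noncomputable def uevKeep (Γ : Set Fml) (u : Uev) : Uev := fun χ₁ χ₂ =>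
  if χ₁ ∈ Γ then u χ₁ χ₂ else none

open Classical in
/-- As `uevKeep`, but the principal formula `π` takes over the values of
its reduct `ρ` in the child. -/
noncomputable def uevPull (π ρ : Fml) (Γ : Set Fml) (u : Uev) : Uev := fun χ₁ χ₂ =>
  if χ₁ = π then u ρ χ₂ else if χ₁ ∈ Γ then u χ₁ χ₂ else none

open Classical in
/-- As `uevPull`, but the pair `(π, π)` becomes undefined. -/
noncomputable def uevFulfil (π ρ : Fml) (Γ : Set Fml) (u : Uev) : Uev := fun χ₁ χ₂ =>
  if χ₁ = π ∧ χ₂ = π then none else uevPull π ρ Γ u χ₁ χ₂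

/-- Pointwise minimum, undefined as soon as one of the arguments is undefined. -/
def uevMin (f g : Uev) : Uev := fun χ₁ χ₂ =>
  match f χ₁ χ₂, g χ₁ χ₂ with
  | some m, some n => some (min m n)
  | _, _ => none

/-- The status of a β-node from the stati of its two children. -/
def betaStat : Status → Status → Status
  | .unsat, .unsat => .unsat
  | .opened, _ => .opened
  | _, .opened => .opened
  | _, _ => .barred

/-- The variables of a β-node from the stati `s₁, s₂` of its children and the
adapted functions `u₁', u₂'`. -/
def betaVars (s₁ s₂ : Status) (u₁' u₂' : Uev) : Vars where
  stat := betaStat s₁ s₂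
  uev := match s₁, s₂ with
    | .opened, .opened => uevMin u₁' u₂'
    | .opened, _ => u₁'
    | _, .opened => u₂'
    | _, _ => uevBot

/-! ### Rules -/

/-- The set of all `ψ` with `[a]ψ ∈ Γ`. -/
def boxArgs (a : ℕ) (Γ : Set Fml) : Set Fml := {ψ | Fml.box (.atom a) ψ ∈ Γ}

/-- The pair that an `⟨⟩`-node with formula set `Γ` assigns to `⟨a⟩φ`. -/
def corePair (Γ : Set Fml) (a : ℕ) (φ : Fml) : Fml × Set Fml :=
  (φ, insert φ (boxArgs a Γ))

/-- The core-node created for `⟨a⟩φ`. -/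
noncomputable def coreSequent (s : Sequent) (a : ℕ) (φ : Fml) : Sequent where
  Γ := insert φ (boxArgs a s.Γ)
  HCr := s.HCr ++ [corePair s.Γ a φ]
  Nx := tst φ
  BD := ∅
  BB := ∅

open Classical in
/-- The status of an `⟨⟩`-node: `len` is the length of its `HCr`, the formulae
`⟨(f i).1⟩(f i).2` are its unblocked diamonds, and `v i` are the variables of the children. -/
noncomputable def diaStat (len : ℕ) {n : ℕ} (f : Fin n → ℕ × Fml) (v : Fin n → Vars) : Status :=
  if ∃ i, (v i).stat ≠ .opened ∨
      ∃ ψ ∈ FmlDiaStar, (f i).2 ∈ pre ψ ∧ ∃ m, (v i).uev (f i).2 ψ = some m ∧ len < (m : ℕ)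
  then .unsat else .opened

open Classical in
/-- The `uev` of an `⟨⟩`-node: an unblocked diamond takes its values from the child that was
created for it, and every other diamond `⟨a⟩φ` of `Γ` gets the level of its proxy. Levels are
counted from `1`, positions `lvl a φ` in the list `HCr` from `0`. -/
noncomputable def diaUev (Γ : Set Fml) (stat : Status) {n : ℕ} (f : Fin n → ℕ × Fml)
    (lvl : ℕ → Fml → ℕ) (v : Fin n → Vars) : Uev := fun χ₁ χ₂ =>
  if stat = .opened ∧ χ₂ ∈ FmlDiaStar ∧ χ₁ ∈ pre χ₂ ∧ χ₁ ∈ Γ then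
    match χ₁ with
    | .dia (.atom a) φ =>
      if h : ∃ i, f i = (a, φ) then (v h.choose).uev φ χ₂ else some (lvl a φ).succPNat
    | _ => none
  else none

open Classical in
/-- `Rule s n c act`: some rule is applicable to a node with formula set and histories `s`;
it creates `n` children with formula sets and histories `c i`, and `act` computes
the variables of the node from those of its children. A rule with `n = 0` creates no child. -/
inductive Rule (s : Sequent) :
    (n : ℕ) → (Fin n → Sequent) → ((Fin n → Vars) → Vars) → Prop
  /- terminal rules -/
  | id (p : ℕ) (hp : Fml.atom p ∈ s.Γ) (hnp : Fml.neg (.atom p) ∈ s.Γ) :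
      Rule s 0 ![] (fun _ => ⟨.unsat, uevBot⟩)
  | diaStar₂ (α : Prg) (φ : Fml) (hmem : Fml.dia (.star α) φ ∈ s.Γ)
      (hNx : s.Nx = none ∨ s.Nx = some (.dia (.star α) φ))
      (hBD : Fml.dia (.star α) φ ∈ s.BD) :
      Rule s 0 ![] (fun _ => ⟨.barred, uevBot⟩)
  /- linear rules -/
  | and (φ ψ : Fml) (Γ : Set Fml) (hΓ : Γ = s.Γ \ {.and φ ψ})
      (hmem : Fml.and φ ψ ∈ s.Γ) (hNx : s.Nx = none) :
      Rule s 1 ![{ s with Γ := {φ, ψ} ∪ Γ }]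
        (fun v => ⟨(v 0).stat, uevKeep Γ (v 0).uev⟩)
  | boxUnion (α β : Prg) (φ : Fml) (Γ : Set Fml) (hΓ : Γ = s.Γ \ {.box (.union α β) φ})
      (hmem : Fml.box (.union α β) φ ∈ s.Γ) (hNx : s.Nx = none) :
      Rule s 1 ![{ s with Γ := {.box α φ, .box β φ} ∪ Γ }]
        (fun v => ⟨(v 0).stat, uevKeep Γ (v 0).uev⟩)
  | boxSeq (α β : Prg) (φ : Fml) (Γ : Set Fml) (hΓ : Γ = s.Γ \ {.box (.seq α β) φ})
      (hmem : Fml.box (.seq α β) φ ∈ s.Γ) (hNx : s.Nx = none) :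
      Rule s 1 ![{ s with Γ := {.box α (.box β φ)} ∪ Γ }]
        (fun v => ⟨(v 0).stat, uevKeep Γ (v 0).uev⟩)
  | boxStar (α : Prg) (φ : Fml) (Γ : Set Fml) (hΓ : Γ = s.Γ \ {.box (.star α) φ})
      (hmem : Fml.box (.star α) φ ∈ s.Γ) (hNx : s.Nx = none) :
      Rule s 1
        ![{ s with
            Γ := if Fml.box (.star α) φ ∈ s.BB then Γ
              else {φ, .box α (.box (.star α) φ)} ∪ Γ
            BB := {.box (.star α) φ} ∪ s.BB }]
        (fun v => ⟨(v 0).stat, uevKeep Γ (v 0).uev⟩)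
  | diaSeq (α β : Prg) (φ : Fml) (Γ : Set Fml) (hΓ : Γ = s.Γ \ {.dia (.seq α β) φ})
      (hmem : Fml.dia (.seq α β) φ ∈ s.Γ)
      (hNx : s.Nx = none ∨ s.Nx = some (.dia (.seq α β) φ)) :
      Rule s 1
        ![{ s with
            Γ := {.dia α (.dia β φ)} ∪ Γ
            Nx := tst (.dia α (.dia β φ))
            BD := bl (.dia α (.dia β φ)) s.BD }]
        (fun v => ⟨(v 0).stat,
          uevPull (.dia (.seq α β) φ) (.dia α (.dia β φ)) Γ (v 0).uev⟩)
  | diaTest (ψ φ : Fml) (Γ : Set Fml) (hΓ : Γ = s.Γ \ {.dia (.test ψ) φ})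
      (hmem : Fml.dia (.test ψ) φ ∈ s.Γ)
      (hNx : s.Nx = none ∨ s.Nx = some (.dia (.test ψ) φ)) :
      Rule s 1
        ![{ s with
            Γ := {ψ, φ} ∪ Γ
            Nx := tst φ
            BD := bl φ s.BD }]
        (fun v => ⟨(v 0).stat, uevPull (.dia (.test ψ) φ) φ Γ (v 0).uev⟩)
  /- universal branching rules -/
  | or (φ₁ φ₂ : Fml) (Γ : Set Fml) (hΓ : Γ = s.Γ \ {.or φ₁ φ₂})
      (hmem : Fml.or φ₁ φ₂ ∈ s.Γ) (hNx : s.Nx = none) :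
      Rule s 2 ![{ s with Γ := {φ₁} ∪ Γ }, { s with Γ := {φ₂} ∪ Γ }]
        (fun v => betaVars (v 0).stat (v 1).stat
          (uevKeep Γ (v 0).uev) (uevKeep Γ (v 1).uev))
  | boxTest (ψ φ : Fml) (Γ : Set Fml) (hΓ : Γ = s.Γ \ {.box (.test ψ) φ})
      (hmem : Fml.box (.test ψ) φ ∈ s.Γ) (hNx : s.Nx = none) :
      Rule s 2 ![{ s with Γ := {ψ.negNNF} ∪ Γ }, { s with Γ := {φ} ∪ Γ }]
        (fun v => betaVars (v 0).stat (v 1).stat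
          (uevKeep Γ (v 0).uev) (uevKeep Γ (v 1).uev))
  | diaUnion (α₁ α₂ : Prg) (φ : Fml) (Γ : Set Fml) (hΓ : Γ = s.Γ \ {.dia (.union α₁ α₂) φ})
      (hmem : Fml.dia (.union α₁ α₂) φ ∈ s.Γ)
      (hNx : s.Nx = none ∨ s.Nx = some (.dia (.union α₁ α₂) φ)) :
      Rule s 2
        ![{ s with
            Γ := {.dia α₁ φ} ∪ Γ
            Nx := tst (.dia α₁ φ)
            BD := bl (.dia α₁ φ) s.BD },
          { s with
            Γ := {.dia α₂ φ} ∪ Γ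
            Nx := tst (.dia α₂ φ)
            BD := bl (.dia α₂ φ) s.BD }]
        (fun v => betaVars (v 0).stat (v 1).stat
          (uevPull (.dia (.union α₁ α₂) φ) (.dia α₁ φ) Γ (v 0).uev)
          (uevPull (.dia (.union α₁ α₂) φ) (.dia α₂ φ) Γ (v 1).uev))
  | diaStar₁ (α : Prg) (φ : Fml) (Γ : Set Fml) (hΓ : Γ = s.Γ \ {.dia (.star α) φ})
      (hmem : Fml.dia (.star α) φ ∈ s.Γ)
      (hNx : s.Nx = none ∨ s.Nx = some (.dia (.star α) φ))
      (hBD : Fml.dia (.star α) φ ∉ s.BD) :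
      Rule s 2
        ![{ s with
            Γ := {φ} ∪ Γ
            Nx := tst φ
            BD := bl φ ({.dia (.star α) φ} ∪ s.BD) },
          { s with
            Γ := {.dia α (.dia (.star α) φ)} ∪ Γ
            Nx := tst (.dia α (.dia (.star α) φ))
            BD := bl (.dia α (.dia (.star α) φ)) ({.dia (.star α) φ} ∪ s.BD) }]
        (fun v => betaVars (v 0).stat (v 1).stat
          (uevFulfil (.dia (.star α) φ) φ Γ (v 0).uev)
          (uevPull (.dia (.star α) φ) (.dia α (.dia (.star α) φ)) Γ (v 1).uev))
  /- existential branching rule: `f` enumerates the diamonds whose pair is not in `HCr`,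
  and `lvl` gives the positions in `HCr` of the pairs of the other diamonds -/
  | dia (n : ℕ) (f : Fin n → ℕ × Fml) (lvl : ℕ → Fml → ℕ)
      (hform : ∀ χ ∈ s.Γ, (∃ p, χ = .atom p) ∨ (∃ p, χ = .neg (.atom p)) ∨
        (∃ a φ, χ = .dia (.atom a) φ) ∨ (∃ a φ, χ = .box (.atom a) φ))
      (hcons : ∀ p, ¬ (Fml.atom p ∈ s.Γ ∧ Fml.neg (.atom p) ∈ s.Γ))
      (hinj : Function.Injective f)
      (hf : ∀ a φ, (∃ i, f i = (a, φ)) ↔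
        Fml.dia (.atom a) φ ∈ s.Γ ∧ corePair s.Γ a φ ∉ s.HCr)
      (hlvl : ∀ a φ, Fml.dia (.atom a) φ ∈ s.Γ → corePair s.Γ a φ ∈ s.HCr →
        s.HCr[lvl a φ]? = some (corePair s.Γ a φ)) :
      Rule s n (fun i => coreSequent s (f i).1 (f i).2)
        (fun v => ⟨diaStat s.HCr.length f v,
          diaUev s.Γ (diaStat s.HCr.length f v) f lvl v⟩)

/-- Some rule can be applied to a node with formula set and histories `s`. -/
def RuleApplicable (s : Sequent) : Prop := ∃ n c act, Rule s n c act

/-! ### Tableaux -/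

/-- A rooted ordered tree with finite branching, possibly with infinite branches. A node is
given by its address: the root is `[]`, and the children of the node `x` are
`i :: x` for `i < arity x`. The values at lists that are not addresses of nodes
are irrelevant. -/
structure NodeTree : Type where
  label : List ℕ → Node
  arity : List ℕ → ℕ

/-- `T.Mem x`: the list `x` is the address of a node of `T`. -/
inductive NodeTree.Mem (T : NodeTree) : List ℕ → Prop
  | root : T.Mem []
  | child (x : List ℕ) (i : ℕ) : T.Mem x → i < T.arity x → T.Mem (i :: x)

/-- The children of `x` are obtained by a single application of a rule to `x`, and
the variables at `x` are computed from those of the children accordingly. -/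
def NodeTree.RuleAppliedAt (T : NodeTree) (x : List ℕ) : Prop :=
  ∃ c act, Rule (T.label x).seq (T.arity x) c act ∧
    (∀ i : Fin (T.arity x), (T.label (i.val :: x)).seq = c i) ∧
    (T.label x).vars = act (fun i => (T.label (i.val :: x)).vars)

/-- A tableau for the formula set and histories `s`. Leaves need not have been treated by
a rule. -/
structure NodeTree.IsTableau (T : NodeTree) (s : Sequent) : Prop where
  root : (T.label []).seq = s
  wellFormed : ∀ x, T.Mem x → (T.label x).WellFormed
  rule : ∀ x, T.Mem x → T.arity x ≠ 0 → T.RuleAppliedAt x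

/-- No rule remains to be applied to a leaf: either a rule without children has
been applied to it, or no rule is applicable. -/
def NodeTree.IsExpanded (T : NodeTree) : Prop :=
  ∀ x, T.Mem x → T.arity x = 0 → T.RuleAppliedAt x ∨ ¬ RuleApplicable (T.label x).seq

end PDL

-- Termination is the first ingredient. All formulae of the tableau lie in a finite set closed under
-- the rules, and a lexicographic measure drops from each node to its children. Its components are
-- the room left in `HCr`, whose entries are distinct pairs over that set; the number of formulae of
-- the set not yet in `BB`; and a weight in which a barred diamond `⟨α*⟩φ` counts nothing. Some rule
-- always applies to a node of the tableau, so every leaf of an expanded tableau has been treated,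
-- and induction from the children to the parent is available (`NodeTree.IsTableau.isComplete`).
--
-- The worlds are the saturated nodes that are open together with all their ancestors. A world is
-- labelled with all formulae met on the path to it since the last use of the existential rule, so a
-- decomposed formula is present together with its components. `R a` leads from `w` to `v` if `v` is
-- reached, without the existential rule, from an open node with formula set `{χ} ∪ Δ_a` for some
-- `⟨a⟩χ` in `w`. Only the formula set of that node matters, not its place in the tree, so a blocked
-- diamond is served by the ancestor that blocks it. H1 to H5 follow; the delicate point is a box
-- dropped because of `BB`, whose components occur earlier on the same path (`IsComplete.bb`).
--
-- H6 rests on the meaning of `uev`. At an open node the pursuit of an eventuality can be continued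
-- to fulfilment, or else its value is some `m` and the pursuit ends at a diamond blocked by the
-- `m`-th entry of `HCr` (`IsComplete.fulfils_or_postpones`). The existential rule stays open only
-- if the value at a child is less than the level of that child, so each postponement leads to a
-- strictly smaller level, and strong induction on levels ends in fulfilment
-- (`IsComplete.exists_fulfils`). From an arbitrary formula in the label of a world, the chain
-- follows the given path down to that world, is fulfilled there or stops at an atomic diamond, and
-- then jumps to a suitable successor (`IsComplete.fulfils`).

namespace PDL

/-! ### A finite closed set of formulae in negation normal form -/

/-- The formulae to which the rules for `m α φ`, where `m` is `Fml.dia` or `Fml.box`, lead,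
up to negation of tests. -/
def modComps (m : Prg → Fml → Fml) : Prg → Fml → Set Fml
  | .atom _, φ => {φ}
  | .test ψ, φ => {φ, ψ}
  | .seq α β, φ => {m α (m β φ)}
  | .union α β, φ => {m α φ, m β φ}
  | .star α, φ => {φ, m α (m (.star α) φ)}

/-- The components of a formula, up to negation of tests. -/
def comps : Fml → Set Fml
  | .atom _ => ∅
  | .neg _ => ∅
  | .and φ ψ => {φ, ψ}
  | .or φ ψ => {φ, ψ}
  | .dia α φ => modComps .dia α φ
  | .box α φ => modComps .box α φ

mutual
/-- A closure of a formula under `comps`. -/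
def Fml.cl : Fml → Set Fml
  | .atom p => {.atom p}
  | .neg φ => {.neg φ}
  | .and φ ψ => {.and φ ψ} ∪ (φ.cl ∪ ψ.cl)
  | .or φ ψ => {.or φ ψ} ∪ (φ.cl ∪ ψ.cl)
  | .dia α φ => α.cl .dia φ ∪ φ.cl
  | .box α φ => α.cl .box φ ∪ φ.cl
/-- A set of formulae that contains `m α φ` and is closed under `comps` except for `φ`. -/
def Prg.cl (m : Prg → Fml → Fml) : Prg → Fml → Set Fml
  | .atom a, φ => {m (.atom a) φ}
  | .test ψ, φ => {m (.test ψ) φ} ∪ ψ.cl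
  | .seq α β, φ => {m (.seq α β) φ} ∪ (α.cl m (m β φ) ∪ β.cl m φ)
  | .union α β, φ => {m (.union α β) φ} ∪ (α.cl m φ ∪ β.cl m φ)
  | .star α, φ => {m (.star α) φ} ∪ α.cl m (m (.star α) φ)
end

mutual
theorem Fml.cl_finite : ∀ φ : Fml, φ.cl.Finite
  | .atom p => by simp [Fml.cl]
  | .neg φ => by simp [Fml.cl]
  | .and φ ψ => by
      rw [Fml.cl]; exact (Set.finite_singleton _).union (φ.cl_finite.union ψ.cl_finite)
  | .or φ ψ => by
      rw [Fml.cl]; exact (Set.finite_singleton _).union (φ.cl_finite.union ψ.cl_finite)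
  | .dia α φ => by rw [Fml.cl]; exact (α.cl_finite _ _).union φ.cl_finite
  | .box α φ => by rw [Fml.cl]; exact (α.cl_finite _ _).union φ.cl_finite
theorem Prg.cl_finite (m : Prg → Fml → Fml) : ∀ (α : Prg) (φ : Fml), (α.cl m φ).Finite
  | .atom a, φ => by simp [Prg.cl]
  | .test ψ, φ => by rw [Prg.cl]; exact (Set.finite_singleton _).union ψ.cl_finite
  | .seq α β, φ => by
      rw [Prg.cl]
      exact (Set.finite_singleton _).union ((α.cl_finite m _).union (β.cl_finite m _))
  | .union α β, φ => by
      rw [Prg.cl]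
      exact (Set.finite_singleton _).union ((α.cl_finite m _).union (β.cl_finite m _))
  | .star α, φ => by rw [Prg.cl]; exact (Set.finite_singleton _).union (α.cl_finite m _)
end

theorem Prg.self_mem_cl (m : Prg → Fml → Fml) (α : Prg) (φ : Fml) : m α φ ∈ α.cl m φ := by
  cases α <;> simp [Prg.cl]

theorem Fml.self_mem_cl (φ : Fml) : φ ∈ φ.cl := by
  cases φ <;> simp [Fml.cl, Prg.self_mem_cl]

mutual
theorem Fml.comps_subset_cl : ∀ φ χ : Fml, χ ∈ φ.cl → comps χ ⊆ φ.cl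
  | .atom p, χ, h => by
      rw [Fml.cl, Set.mem_singleton_iff] at h; subst h; simp [comps]
  | .neg φ, χ, h => by
      rw [Fml.cl, Set.mem_singleton_iff] at h; subst h; simp [comps]
  | .and φ ψ, χ, h => by
      have h₁ := φ.comps_subset_cl χ
      have h₂ := ψ.comps_subset_cl χ
      have h₃ := φ.self_mem_cl
      have h₄ := ψ.self_mem_cl
      rw [Fml.cl] at h ⊢
      rcases h with h | h | h
      · rw [Set.mem_singleton_iff] at h; subst h
        rintro x (rfl | rfl) <;> simp_all
      · exact fun x hx => .inr (.inl (h₁ h hx))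
      · exact fun x hx => .inr (.inr (h₂ h hx))
  | .or φ ψ, χ, h => by
      have h₁ := φ.comps_subset_cl χ
      have h₂ := ψ.comps_subset_cl χ
      have h₃ := φ.self_mem_cl
      have h₄ := ψ.self_mem_cl
      rw [Fml.cl] at h ⊢
      rcases h with h | h | h
      · rw [Set.mem_singleton_iff] at h; subst h
        rintro x (rfl | rfl) <;> simp_all
      · exact fun x hx => .inr (.inl (h₁ h hx))
      · exact fun x hx => .inr (.inr (h₂ h hx))
  | .dia α φ, χ, h => by
      rw [Fml.cl] at h ⊢
      rcases h with h | h
      · intro x hx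
        rcases α.comps_subset_cl .dia (fun _ _ => rfl) φ χ h hx with rfl | hx
        · exact .inr x.self_mem_cl
        · exact .inl hx
      · exact fun x hx => .inr (φ.comps_subset_cl χ h hx)
  | .box α φ, χ, h => by
      rw [Fml.cl] at h ⊢
      rcases h with h | h
      · intro x hx
        rcases α.comps_subset_cl .box (fun _ _ => rfl) φ χ h hx with rfl | hx
        · exact .inr x.self_mem_cl
        · exact .inl hx
      · exact fun x hx => .inr (φ.comps_subset_cl χ h hx)
-- The continuation `φ` is the only component that can escape. For a sequence, what escapes from the
-- first program is `m β φ`, which the second closure contains; for a star, it is the starred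
-- formula itself. Hence the recursion can be structural in the program although unfolding a star
-- does not shrink the formula.
theorem Prg.comps_subset_cl (m : Prg → Fml → Fml) (hm : ∀ α φ, comps (m α φ) = modComps m α φ) :
    ∀ (α : Prg) (φ χ : Fml), χ ∈ α.cl m φ → comps χ ⊆ insert φ (α.cl m φ)
  | .atom a, φ, χ, h => by
      rw [Prg.cl, Set.mem_singleton_iff] at h; subst h
      rw [hm, modComps]; rintro x rfl; exact .inl rfl
  | .test ψ, φ, χ, h => by
      have h₁ := ψ.comps_subset_cl χ
      have h₂ := ψ.self_mem_cl
      rw [Prg.cl] at h ⊢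
      rcases h with h | h
      · rw [Set.mem_singleton_iff] at h; subst h
        rw [hm, modComps]
        rintro x (rfl | rfl)
        · exact .inl rfl
        · exact .inr (.inr h₂)
      · exact fun x hx => .inr (.inr (h₁ h hx))
  | .seq α β, φ, χ, h => by
      have h₁ := α.comps_subset_cl m hm (m β φ) χ
      have h₂ := β.comps_subset_cl m hm φ χ
      rw [Prg.cl] at h ⊢
      rcases h with h | h | h
      · rw [Set.mem_singleton_iff] at h; subst h
        rw [hm, modComps]; rintro x rfl
        exact .inr (.inr (.inl (α.self_mem_cl m _)))
      · intro x hx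
        rcases h₁ h hx with rfl | hx
        · exact .inr (.inr (.inr (β.self_mem_cl m _)))
        · exact .inr (.inr (.inl hx))
      · intro x hx
        rcases h₂ h hx with rfl | hx
        · exact .inl rfl
        · exact .inr (.inr (.inr hx))
  | .union α β, φ, χ, h => by
      have h₁ := α.comps_subset_cl m hm φ χ
      have h₂ := β.comps_subset_cl m hm φ χ
      rw [Prg.cl] at h ⊢
      rcases h with h | h | h
      · rw [Set.mem_singleton_iff] at h; subst h
        rw [hm, modComps]
        rintro x (rfl | rfl)
        · exact .inr (.inr (.inl (α.self_mem_cl m _)))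
        · exact .inr (.inr (.inr (β.self_mem_cl m _)))
      · intro x hx
        rcases h₁ h hx with rfl | hx
        · exact .inl rfl
        · exact .inr (.inr (.inl hx))
      · intro x hx
        rcases h₂ h hx with rfl | hx
        · exact .inl rfl
        · exact .inr (.inr (.inr hx))
  | .star α, φ, χ, h => by
      have h₁ := α.comps_subset_cl m hm (m (.star α) φ) χ
      rw [Prg.cl] at h ⊢
      rcases h with h | h
      · rw [Set.mem_singleton_iff] at h; subst h
        rw [hm, modComps]
        rintro x (rfl | rfl)
        · exact .inl rfl
        · exact .inr (.inr (α.self_mem_cl m _))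
      · intro x hx
        rcases h₁ h hx with rfl | hx
        · exact .inr (.inl rfl)
        · exact .inr (.inr hx)
end

mutual
theorem Fml.isNNF_of_mem_cl : ∀ φ : Fml, φ.IsNNF → ∀ χ ∈ φ.cl, χ.IsNNF
  | .atom p, hφ, χ, h => by rw [Fml.cl, Set.mem_singleton_iff] at h; exact h ▸ hφ
  | .neg φ, hφ, χ, h => by rw [Fml.cl, Set.mem_singleton_iff] at h; exact h ▸ hφ
  | .and φ ψ, hφ, χ, h => by
      have hφ' := hφ
      rw [Fml.IsNNF] at hφ'
      rw [Fml.cl] at h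
      rcases h with rfl | h | h
      exacts [hφ, φ.isNNF_of_mem_cl hφ'.1 χ h, ψ.isNNF_of_mem_cl hφ'.2 χ h]
  | .or φ ψ, hφ, χ, h => by
      have hφ' := hφ
      rw [Fml.IsNNF] at hφ'
      rw [Fml.cl] at h
      rcases h with rfl | h | h
      exacts [hφ, φ.isNNF_of_mem_cl hφ'.1 χ h, ψ.isNNF_of_mem_cl hφ'.2 χ h]
  | .dia α φ, hφ, χ, h => by
      rw [Fml.IsNNF] at hφ
      rw [Fml.cl] at h
      rcases h with h | h
      exacts [α.isNNF_of_mem_cl .dia (fun _ _ h₁ h₂ => by rw [Fml.IsNNF]; exact ⟨h₁, h₂⟩)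
        hφ.1 φ hφ.2 χ h, φ.isNNF_of_mem_cl hφ.2 χ h]
  | .box α φ, hφ, χ, h => by
      rw [Fml.IsNNF] at hφ
      rw [Fml.cl] at h
      rcases h with h | h
      exacts [α.isNNF_of_mem_cl .box (fun _ _ h₁ h₂ => by rw [Fml.IsNNF]; exact ⟨h₁, h₂⟩)
        hφ.1 φ hφ.2 χ h, φ.isNNF_of_mem_cl hφ.2 χ h]
theorem Prg.isNNF_of_mem_cl (m : Prg → Fml → Fml)
    (hm : ∀ α φ, α.IsNNF → φ.IsNNF → (m α φ).IsNNF) :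
    ∀ α : Prg, α.IsNNF → ∀ φ : Fml, φ.IsNNF → ∀ χ ∈ α.cl m φ, χ.IsNNF
  | .atom a, hα, φ, hφ, χ, h => by
      rw [Prg.cl, Set.mem_singleton_iff] at h; exact h ▸ hm _ _ hα hφ
  | .test ψ, hα, φ, hφ, χ, h => by
      have hα' := hα
      rw [Prg.IsNNF] at hα'
      rw [Prg.cl] at h
      rcases h with rfl | h
      exacts [hm _ _ hα hφ, ψ.isNNF_of_mem_cl hα' χ h]
  | .seq α β, hα, φ, hφ, χ, h => by
      have hα' := hα
      rw [Prg.IsNNF] at hα'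
      rw [Prg.cl] at h
      rcases h with rfl | h | h
      exacts [hm _ _ hα hφ, α.isNNF_of_mem_cl m hm hα'.1 _ (hm _ _ hα'.2 hφ) χ h,
        β.isNNF_of_mem_cl m hm hα'.2 _ hφ χ h]
  | .union α β, hα, φ, hφ, χ, h => by
      have hα' := hα
      rw [Prg.IsNNF] at hα'
      rw [Prg.cl] at h
      rcases h with rfl | h | h
      exacts [hm _ _ hα hφ, α.isNNF_of_mem_cl m hm hα'.1 _ hφ χ h,
        β.isNNF_of_mem_cl m hm hα'.2 _ hφ χ h]
  | .star α, hα, φ, hφ, χ, h => by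
      have hα' := hα
      rw [Prg.IsNNF] at hα'
      rw [Prg.cl] at h
      rcases h with rfl | h
      exacts [hm _ _ hα hφ, α.isNNF_of_mem_cl m hm hα' _ (hm _ _ hα hφ) χ h]
end

mutual
-- Consequently `∼` leaves the programs of a formula in negation normal form unchanged, so negating
-- a closure produces no renormalised programs.
theorem Fml.nnfAux_true_eq_self : ∀ φ : Fml, φ.IsNNF → Fml.nnfAux true φ = φ
  | .atom p, _ => by simp [Fml.nnfAux]
  | .neg (.atom p), _ => by simp [Fml.nnfAux]
  | .neg (.neg _), h | .neg (.and _ _), h | .neg (.or _ _), h | .neg (.dia _ _), h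
  | .neg (.box _ _), h => by simp [Fml.IsNNF] at h
  | .and φ ψ, h => by
      rw [Fml.IsNNF] at h
      rw [Fml.nnfAux, φ.nnfAux_true_eq_self h.1, ψ.nnfAux_true_eq_self h.2]
  | .or φ ψ, h => by
      rw [Fml.IsNNF] at h
      rw [Fml.nnfAux, φ.nnfAux_true_eq_self h.1, ψ.nnfAux_true_eq_self h.2]
  | .dia α φ, h => by
      rw [Fml.IsNNF] at h
      rw [Fml.nnfAux, φ.nnfAux_true_eq_self h.2, α.nnf_eq_self h.1]
  | .box α φ, h => by
      rw [Fml.IsNNF] at h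
      rw [Fml.nnfAux, φ.nnfAux_true_eq_self h.2, α.nnf_eq_self h.1]
theorem Prg.nnf_eq_self : ∀ α : Prg, α.IsNNF → α.nnf = α
  | .atom a, _ => by simp [Prg.nnf]
  | .test φ, h => by
      rw [Prg.IsNNF] at h
      rw [Prg.nnf, φ.nnfAux_true_eq_self h]
  | .seq α β, h => by
      rw [Prg.IsNNF] at h
      rw [Prg.nnf, α.nnf_eq_self h.1, β.nnf_eq_self h.2]
  | .union α β, h => by
      rw [Prg.IsNNF] at h
      rw [Prg.nnf, α.nnf_eq_self h.1, β.nnf_eq_self h.2]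
  | .star α, h => by
      rw [Prg.IsNNF] at h
      rw [Prg.nnf, α.nnf_eq_self h]
end

mutual
theorem Fml.isNNF_nnfAux : ∀ (b : Bool) (φ : Fml), (Fml.nnfAux b φ).IsNNF
  | true, .atom p => by simp [Fml.nnfAux, Fml.IsNNF]
  | false, .atom p => by simp [Fml.nnfAux, Fml.IsNNF]
  | b, .neg φ => by rw [Fml.nnfAux]; exact Fml.isNNF_nnfAux _ φ
  | true, .and φ ψ | false, .and φ ψ | true, .or φ ψ | false, .or φ ψ => by
      rw [Fml.nnfAux, Fml.IsNNF]; exact ⟨Fml.isNNF_nnfAux _ φ, Fml.isNNF_nnfAux _ ψ⟩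
  | true, .dia α φ | false, .dia α φ | true, .box α φ | false, .box α φ => by
      rw [Fml.nnfAux, Fml.IsNNF]; exact ⟨Prg.isNNF_nnf α, Fml.isNNF_nnfAux _ φ⟩
theorem Prg.isNNF_nnf : ∀ α : Prg, α.nnf.IsNNF
  | .atom a => by simp [Prg.nnf, Prg.IsNNF]
  | .test φ => by rw [Prg.nnf, Prg.IsNNF]; exact Fml.isNNF_nnfAux _ φ
  | .seq α β => by rw [Prg.nnf, Prg.IsNNF]; exact ⟨α.isNNF_nnf, β.isNNF_nnf⟩
  | .union α β => by rw [Prg.nnf, Prg.IsNNF]; exact ⟨α.isNNF_nnf, β.isNNF_nnf⟩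
  | .star α => by rw [Prg.nnf, Prg.IsNNF]; exact α.isNNF_nnf
end

/-- The formulae to which the rules lead from a given formula. -/
def ruleComps : Fml → Set Fml
  | .box (.test ψ) φ => {φ, ψ.negNNF}
  | χ => comps χ

/-- A set of formulae in negation normal form that the rules do not leave. -/
structure IsRuleClosed (C : Set Fml) : Prop where
  isNNF : ∀ χ ∈ C, χ.IsNNF
  comps : ∀ χ ∈ C, ruleComps χ ⊆ C

/-- The rule for `[ψ?]φ` introduces `∼ψ`, which is why negations are adjoined. One round suffices,
because decomposition commutes with `∼` up to the tests. -/
theorem isRuleClosed_cl {φ : Fml} (hφ : φ.IsNNF) :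
    IsRuleClosed (φ.cl ∪ Fml.negNNF '' φ.cl) where
  isNNF := by
    rintro χ (h | ⟨θ, -, rfl⟩)
    · exact φ.isNNF_of_mem_cl hφ χ h
    · exact Fml.isNNF_nnfAux _ _
  comps := by
    rintro χ (h | ⟨θ, h, rfl⟩)
    · have hc := φ.comps_subset_cl χ h
      intro x hx
      unfold ruleComps at hx
      split at hx
      · rcases hx with rfl | rfl
        · exact .inl (hc (.inl rfl))
        · exact .inr ⟨_, hc (.inr rfl), rfl⟩
      · exact .inl (hc hx)
    · have hc := φ.comps_subset_cl θ h
      have hn := φ.isNNF_of_mem_cl hφ θ h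
      have hneg : ∀ x ∈ PDL.comps θ, x.negNNF ∈ φ.cl ∪ Fml.negNNF '' φ.cl :=
        fun x hx => .inr ⟨x, hc hx, rfl⟩
      -- The first set on the right is needed for `θ = [ψ?]χ`: its negation is `⟨ψ?⟩∼χ`, whose
      -- component `ψ` is not negated.
      have key : ruleComps θ.negNNF ⊆ PDL.comps θ ∪ Fml.negNNF '' PDL.comps θ := by
        rcases θ with p | χ | ⟨χ, ψ⟩ | ⟨χ, ψ⟩ | ⟨α, χ⟩ | ⟨α, χ⟩
        · simp [Fml.negNNF, Fml.nnf, Fml.nnfAux, ruleComps, PDL.comps]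
        · cases χ <;> simp [Fml.IsNNF] at hn
          simp [Fml.negNNF, Fml.nnf, Fml.nnfAux, ruleComps, PDL.comps]
        · simp [Fml.negNNF, Fml.nnf, Fml.nnfAux, ruleComps, PDL.comps, Set.image_insert_eq,
            Set.insert_subset_iff]
        · simp [Fml.negNNF, Fml.nnf, Fml.nnfAux, ruleComps, PDL.comps, Set.image_insert_eq,
            Set.insert_subset_iff]
        all_goals
          rw [Fml.IsNNF] at hn
          have hα := α.nnf_eq_self hn.1
          cases α <;>
          simp_all [Fml.negNNF, Fml.nnf, Fml.nnfAux, ruleComps, PDL.comps, modComps,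
            Prg.nnf, Set.image_insert_eq, Set.insert_subset_iff]
      intro x hx
      rcases key hx with hx | ⟨y, hy, rfl⟩
      · exact .inl (hc hx)
      · exact hneg y hy

/-! ### Weights of formulae -/

open Classical in
mutual
/-- The weight of a formula: it bounds the work that the rules other than the existential one
spend on it, provided that no formula `⟨α*⟩φ ∈ B` is unfolded and no box is unfolded twice. -/
noncomputable def Fml.wt : Fml → Set Fml → ℕ
  | .atom _, _ => 0
  | .neg φ, _ => φ.wt ∅
  | .and φ ψ, _ => 1 + (φ.wt ∅ + ψ.wt ∅)
  | .or φ ψ, _ => 1 + (φ.wt ∅ + ψ.wt ∅)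
  | .dia α φ, B => α.wt B φ (φ.wt B)
  | .box α φ, _ => α.wt ∅ φ (φ.wt ∅)
/-- The weight of `⟨α⟩φ`, given the weight `k` of `φ`. -/
noncomputable def Prg.wt : Prg → Set Fml → Fml → ℕ → ℕ
  | .atom _, _, _, _ => 0
  | .test ψ, _, _, k => 1 + (ψ.wt ∅ + k)
  | .seq α β, B, φ, k => 1 + α.wt B (.dia β φ) (β.wt B φ k)
  | .union α β, B, φ, k => 1 + (α.wt B φ k + β.wt B φ k)
  | .star α, B, φ, k =>
      if Fml.dia (.star α) φ ∈ B then 0 else 1 + (k + α.wt B (.dia (.star α) φ) 0)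
end

theorem Fml.wt_dia (α : Prg) (φ : Fml) (B : Set Fml) :
    (Fml.dia α φ).wt B = α.wt B φ (φ.wt B) := by rw [Fml.wt]

theorem Fml.wt_box (α : Prg) (φ : Fml) (B : Set Fml) :
    (Fml.box α φ).wt B = α.wt ∅ φ (φ.wt ∅) := by rw [Fml.wt]

/-- The formula argument serves only to test membership in the barred set. This makes the weights of
boxes and diamonds comparable, although `Prg.wt` always forms diamonds. -/
theorem Prg.wt_empty_congr : ∀ (α : Prg) (φ ψ : Fml) (k : ℕ), α.wt ∅ φ k = α.wt ∅ ψ k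
  | .atom _, _, _, _ => by simp [Prg.wt]
  | .test _, _, _, _ => by simp [Prg.wt]
  | .seq α β, φ, ψ, k => by
      simp only [Prg.wt]
      rw [β.wt_empty_congr φ ψ k, α.wt_empty_congr (.dia β φ) (.dia β ψ)]
  | .union α β, φ, ψ, k => by
      simp only [Prg.wt]
      rw [β.wt_empty_congr φ ψ k, α.wt_empty_congr φ ψ]
  | .star α, φ, ψ, k => by
      simp only [Prg.wt, Set.mem_empty_iff_false, if_false]
      rw [α.wt_empty_congr (.dia (.star α) φ) (.dia (.star α) ψ)]

mutual
-- With nothing barred, weights see neither polarity nor the difference between box and diamond. So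
-- the summand for `ψ` in the weight of `[ψ?]φ` also pays for `∼ψ`.
theorem Fml.wt_nnfAux : ∀ (b : Bool) (φ : Fml), (Fml.nnfAux b φ).wt ∅ = φ.wt ∅
  | true, .atom p => by simp [Fml.nnfAux]
  | false, .atom p => by simp [Fml.nnfAux, Fml.wt]
  | b, .neg φ => by rw [Fml.nnfAux, Fml.wt_nnfAux _ φ, Fml.wt]
  | true, .and φ ψ | false, .and φ ψ | true, .or φ ψ | false, .or φ ψ => by
      simp only [Fml.nnfAux, Fml.wt]; rw [Fml.wt_nnfAux _ φ, Fml.wt_nnfAux _ ψ]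
  | true, .dia α φ | false, .dia α φ | true, .box α φ | false, .box α φ => by
      simp only [Fml.nnfAux, Fml.wt]
      rw [Fml.wt_nnfAux _ φ, Prg.wt_nnf α _ φ]
theorem Prg.wt_nnf : ∀ (α : Prg) (φ ψ : Fml) (k : ℕ), α.nnf.wt ∅ φ k = α.wt ∅ ψ k
  | .atom a, _, _, _ => by simp [Prg.nnf, Prg.wt]
  | .test χ, _, _, _ => by simp only [Prg.nnf, Prg.wt]; rw [Fml.wt_nnfAux _ χ]
  | .seq α β, φ, ψ, k => by
      simp only [Prg.nnf, Prg.wt]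
      rw [Prg.wt_nnf β φ ψ, Prg.wt_nnf α _ (.dia β ψ)]
  | .union α β, φ, ψ, k => by
      simp only [Prg.nnf, Prg.wt]
      rw [Prg.wt_nnf β φ ψ, Prg.wt_nnf α φ ψ]
  | .star α, φ, ψ, k => by
      simp only [Prg.nnf, Prg.wt, Set.mem_empty_iff_false, if_false]
      rw [Prg.wt_nnf α _ (.dia (.star α) ψ)]
end

theorem Fml.wt_negNNF (φ : Fml) : φ.negNNF.wt ∅ = φ.wt ∅ := by
  rw [Fml.negNNF, Fml.nnf, Fml.wt_nnfAux, Fml.wt]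

theorem Prg.wt_mono {B B' : Set Fml} (hB : B ⊆ B') :
    ∀ (α : Prg) (φ : Fml) {k k' : ℕ}, k' ≤ k → α.wt B' φ k' ≤ α.wt B φ k
  | .atom _, _, _, _, _ => by simp [Prg.wt]
  | .test _, _, _, _, h => by simp only [Prg.wt]; omega
  | .seq α β, φ, _, _, h => by
      simp only [Prg.wt]
      have := α.wt_mono hB (.dia β φ) (β.wt_mono hB φ h)
      omega
  | .union α β, φ, _, _, h => by
      simp only [Prg.wt]
      have h₁ := α.wt_mono hB φ h
      have h₂ := β.wt_mono hB φ h
      omega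
  | .star α, φ, k, k', h => by
      simp only [Prg.wt]
      have h₁ := α.wt_mono hB (.dia (.star α) φ) (le_refl 0)
      by_cases h₂ : Fml.dia (.star α) φ ∈ B'
      · rw [if_pos h₂]; exact Nat.zero_le _
      · rw [if_neg h₂, if_neg fun h => h₂ (hB h)]; omega

theorem Fml.wt_mono {B B' : Set Fml} (hB : B ⊆ B') : ∀ φ : Fml, φ.wt B' ≤ φ.wt B
  | .atom _ | .neg _ | .and _ _ | .or _ _ | .box _ _ => by simp [Fml.wt]
  | .dia α φ => by simp only [Fml.wt]; exact α.wt_mono hB φ (φ.wt_mono hB)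

/-- Barring affects only diamonds with non-atomic program; therefore resetting `BD` by `bl` at any
other reduct costs nothing. -/
theorem Fml.wt_eq_of_notMem {φ : Fml} (h : φ ∉ FmlDiaNonatomic) (B : Set Fml) :
    φ.wt B = φ.wt ∅ := by
  cases φ with
  | dia α φ =>
    cases α with
    | atom a => simp [Fml.wt, Prg.wt]
    | _ => exact absurd ⟨_, _, rfl, by simp⟩ h
  | _ => simp [Fml.wt]

theorem Fml.wt_diaStar_left {α : Prg} {φ : Fml} {B : Set Fml}
    (hB : Fml.dia (.star α) φ ∉ B) :
    φ.wt ({.dia (.star α) φ} ∪ B) < (Fml.dia (.star α) φ).wt B := by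
  have h := φ.wt_mono (B := B) (B' := {.dia (.star α) φ} ∪ B) Set.subset_union_right
  rw [Fml.wt, Prg.wt, if_neg hB]; omega

/-- Once `⟨α*⟩φ` is barred it weighs 0, and 0 is exactly the weight that `Prg.wt` assigns to the
continuation when it unfolds a star. -/
theorem Fml.wt_diaStar_right {α : Prg} {φ : Fml} {B : Set Fml}
    (hB : Fml.dia (.star α) φ ∉ B) :
    (Fml.dia α (.dia (.star α) φ)).wt ({.dia (.star α) φ} ∪ B) <
      (Fml.dia (.star α) φ).wt B := by
  have h₀ : (Fml.dia (.star α) φ).wt ({.dia (.star α) φ} ∪ B) = 0 := by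
    rw [Fml.wt, Prg.wt, if_pos (.inl rfl)]
  have h := α.wt_mono (B := B) (B' := {.dia (.star α) φ} ∪ B) Set.subset_union_right
    (.dia (.star α) φ) (le_refl 0)
  rw [Fml.wt, h₀, Fml.wt, Prg.wt, if_neg hB]; omega

theorem Fml.wt_boxSeq (α β : Prg) (φ : Fml) (B : Set Fml) :
    (Fml.box α (.box β φ)).wt B < (Fml.box (.seq α β) φ).wt B := by
  simp only [Fml.wt, Prg.wt]
  rw [α.wt_empty_congr (.box β φ) (.dia β φ)]; omega

/-! ### Weights of sets of formulae -/

open Classical in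
/-- The sum of the weights of the formulae in `Γ`, of which only those in `C` are counted. -/
noncomputable def mass (C : Finset Fml) (Γ : Set Fml) : ℕ :=
  ∑ χ ∈ C, if χ ∈ Γ then χ.wt ∅ else 0

theorem mass_mono (C : Finset Fml) {Γ Γ' : Set Fml} (h : Γ ⊆ Γ') : mass C Γ ≤ mass C Γ' := by
  refine Finset.sum_le_sum fun χ _ => ?_
  by_cases h₁ : χ ∈ Γ
  · rw [if_pos h₁, if_pos (h h₁)]
  · rw [if_neg h₁]; exact Nat.zero_le _

theorem mass_insert_le (C : Finset Fml) (φ : Fml) (Γ : Set Fml) :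
    mass C (insert φ Γ) ≤ φ.wt ∅ + mass C Γ := by
  classical
  unfold mass
  calc _ ≤ ∑ χ ∈ C, ((if χ = φ then φ.wt ∅ else 0) + if χ ∈ Γ then χ.wt ∅ else 0) := by
        refine Finset.sum_le_sum fun χ _ => ?_
        by_cases h₁ : χ = φ
        · subst h₁; simp
        · simp [h₁]
    _ = (∑ χ ∈ C, if χ = φ then φ.wt ∅ else 0) + _ := Finset.sum_add_distrib
    _ ≤ _ := by
        gcongr
        rw [Finset.sum_ite_eq']
        split <;> simp

theorem mass_sdiff_add {C : Finset Fml} {φ : Fml} {Γ : Set Fml} (hC : φ ∈ C) (hΓ : φ ∈ Γ) :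
    mass C (Γ \ {φ}) + φ.wt ∅ = mass C Γ := by
  classical
  unfold mass
  rw [← Finset.add_sum_erase _ _ hC, ← Finset.add_sum_erase C _ hC, if_neg (by simp), if_pos hΓ,
    zero_add, add_comm]
  congr 1
  refine Finset.sum_congr rfl fun χ hχ => ?_
  simp [Finset.ne_of_mem_erase hχ]

/-- The weight of a sequent; the formula designated by `Nx` is weighed relative to `BD`. -/
noncomputable def Sequent.mass (C : Finset Fml) (s : Sequent) : ℕ :=
  match s.Nx with
  | none => PDL.mass C s.Γ
  | some π => PDL.mass C (s.Γ \ {π}) + π.wt s.BD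

/-! ### Termination -/

theorem tst_of_mem {χ : Fml} (h : χ ∈ FmlDiaNonatomic) : tst χ = some χ := if_pos h
theorem tst_of_notMem {χ : Fml} (h : χ ∉ FmlDiaNonatomic) : tst χ = none := if_neg h
theorem bl_of_mem {χ : Fml} (h : χ ∈ FmlDiaNonatomic) (B : Set Fml) : bl χ B = B := if_pos h
theorem bl_of_notMem {χ : Fml} (h : χ ∉ FmlDiaNonatomic) (B : Set Fml) : bl χ B = ∅ := if_neg h

theorem tst_eq_some {χ π : Fml} (h : tst χ = some π) : χ = π ∧ π ∈ FmlDiaNonatomic := by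
  by_cases hχ : χ ∈ FmlDiaNonatomic
  · rw [tst_of_mem hχ, Option.some_inj] at h
    exact ⟨h, h ▸ hχ⟩
  · rw [tst_of_notMem hχ] at h; cases h

theorem notMem_of_tst_eq_none {χ : Fml} (h : tst χ = none) : χ ∉ FmlDiaNonatomic := fun hχ => by
  rw [tst_of_mem hχ] at h; cases h

/-- The properties of the sequents in a tableau that guarantee termination. -/
structure Sequent.Inv (C : Finset Fml) (s : Sequent) : Prop where
  sub : s.Γ ⊆ C
  nx : ∀ π, s.Nx = some π → π ∈ s.Γ ∧ π ∈ FmlDiaNonatomic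
  bd : s.Nx = none → s.BD = ∅
  nodup : s.HCr.Nodup
  hcr : ∀ e ∈ s.HCr, e.1 ∈ C ∧ e.2 ⊆ C

/-- A bound for the length of `HCr`. -/
noncomputable def hcrBound (C : Finset Fml) : ℕ := ((C : Set Fml) ×ˢ 𝒫 (C : Set Fml)).ncard

theorem Sequent.Inv.length_le {C : Finset Fml} {s : Sequent} (h : s.Inv C) :
    s.HCr.length ≤ hcrBound C := by
  classical
  have hfin : ((C : Set Fml) ×ˢ 𝒫 (C : Set Fml)).Finite :=
    C.finite_toSet.prod C.finite_toSet.finite_subsets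
  rw [← List.toFinset_card_of_nodup h.nodup, ← Set.ncard_coe_finset]
  refine Set.ncard_le_ncard (fun e he => ?_) hfin
  exact h.hcr e (by simpa using he)

open Classical in
/-- The measure that decreases from a node to its children. -/
noncomputable def Sequent.measure (C : Finset Fml) (s : Sequent) : ℕ ×ₗ ℕ ×ₗ ℕ :=
  toLex (hcrBound C - s.HCr.length, toLex ((C.filter (· ∉ s.BB)).card, s.mass C))

theorem Sequent.measure_lt_of_mass {C : Finset Fml} {s s' : Sequent} (h₁ : s'.HCr = s.HCr)
    (h₂ : s'.BB = s.BB) (h₃ : s'.mass C < s.mass C) : s'.measure C < s.measure C := by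
  unfold Sequent.measure
  rw [h₁, h₂]
  exact Prod.Lex.right _ (Prod.Lex.right _ h₃)

/-- The first unfolding of `[α*]φ` may increase the mass, so `BB` has to rank above it. -/
theorem Sequent.measure_lt_of_BB {C : Finset Fml} {s s' : Sequent} {π : Fml}
    (h₁ : s'.HCr = s.HCr) (hπ : π ∈ C) (h : π ∉ s.BB) (h₂ : s'.BB = {π} ∪ s.BB) :
    s'.measure C < s.measure C := by
  classical
  unfold Sequent.measure
  rw [h₁]
  refine Prod.Lex.right _ (Prod.Lex.left _ _ (Finset.card_lt_card ?_))
  rw [Finset.ssubset_iff_of_subset]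
  · exact ⟨π, by simp [hπ, h], by simp [h₂]⟩
  · intro χ
    simp only [Finset.mem_filter, h₂]
    exact fun ⟨h₁, h₂⟩ => ⟨h₁, fun h => h₂ (.inr h)⟩

theorem Sequent.measure_lt_of_hcr {C : Finset Fml} {s s' : Sequent}
    (h₁ : s.HCr.length < s'.HCr.length) (h₂ : s'.HCr.length ≤ hcrBound C) :
    s'.measure C < s.measure C :=
  Prod.Lex.left _ _ (by omega)

/-- The two cases of `Sequent.mass` agree at a designated formula because `BD` is empty as long as
nothing is prescribed by `Nx`. -/
theorem Sequent.Inv.mass_eq {C : Finset Fml} {s : Sequent} (h : s.Inv C) {π : Fml}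
    (hπ : π ∈ s.Γ) (hNx : s.Nx = none ∨ s.Nx = some π) :
    s.mass C = PDL.mass C (s.Γ \ {π}) + π.wt s.BD := by
  unfold Sequent.mass
  rcases hNx with hNx | hNx
  · simp only [hNx, h.bd hNx]
    exact (mass_sdiff_add (h.sub hπ) hπ).symm
  · simp only [hNx]

theorem Sequent.Inv.of_nx_none {C : Finset Fml} {s s' : Sequent} (h : s.Inv C)
    (hNx : s.Nx = none) (hNx' : s'.Nx = s.Nx) (hBD : s'.BD = s.BD) (hHCr : s'.HCr = s.HCr)
    (hC : s'.Γ ⊆ C) : s'.Inv C where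
  sub := hC
  nx := fun π h => by simp [hNx', hNx] at h
  bd := fun _ => by rw [hBD, h.bd hNx]
  nodup := hHCr ▸ h.nodup
  hcr := hHCr ▸ h.hcr

theorem Sequent.Inv.child_of_nx_none {C : Finset Fml} {s : Sequent} (h : s.Inv C)
    (hNx : s.Nx = none) {π : Fml} (hπ : π ∈ s.Γ) {Γ : Set Fml} (hC : Γ ⊆ C)
    (hlt : PDL.mass C Γ < PDL.mass C (s.Γ \ {π}) + π.wt ∅) :
    ({ s with Γ := Γ } : Sequent).Inv C ∧
      ({ s with Γ := Γ } : Sequent).measure C < s.measure C := by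
  refine ⟨h.of_nx_none hNx rfl rfl rfl hC, Sequent.measure_lt_of_mass rfl rfl ?_⟩
  rw [h.mass_eq hπ (.inl hNx), h.bd hNx]
  simpa only [Sequent.mass, hNx] using hlt

/-- If `ρ` is complex it becomes the prescribed formula and is weighed relative to `B`. Otherwise
`BD` is reset, and the weight of `ρ` does not depend on the barred set. -/
theorem Sequent.Inv.child_of_reduct {C : Finset Fml} {s : Sequent} (h : s.Inv C) {π ρ : Fml}
    (hπ : π ∈ s.Γ) (hNx : s.Nx = none ∨ s.Nx = some π) {Γ Δ B : Set Fml} (hρ : ρ ∈ Γ)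
    (hΓ : Γ ⊆ insert ρ Δ) (hC : Γ ⊆ C)
    (hlt : PDL.mass C Δ + ρ.wt B < PDL.mass C (s.Γ \ {π}) + π.wt s.BD) :
    ({ s with Γ := Γ, Nx := tst ρ, BD := bl ρ B } : Sequent).Inv C ∧
      ({ s with Γ := Γ, Nx := tst ρ, BD := bl ρ B } : Sequent).measure C < s.measure C := by
  refine ⟨⟨hC, fun χ hχ => ?_, fun hχ => bl_of_notMem (notMem_of_tst_eq_none hχ) _, h.nodup,
    h.hcr⟩, Sequent.measure_lt_of_mass rfl rfl ?_⟩
  · obtain ⟨rfl, h₁⟩ := tst_eq_some hχ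
    exact ⟨hρ, h₁⟩
  · rw [h.mass_eq hπ hNx]
    refine lt_of_le_of_lt ?_ hlt
    unfold Sequent.mass
    by_cases hc : ρ ∈ FmlDiaNonatomic
    · simp only [tst_of_mem hc, bl_of_mem hc]
      gcongr
      refine mass_mono C fun χ hχ => ?_
      rcases hΓ hχ.1 with h₁ | h₁
      exacts [absurd h₁ hχ.2, h₁]
    · simp only [tst_of_notMem hc]
      rw [Fml.wt_eq_of_notMem hc, add_comm]
      exact (mass_mono C hΓ).trans (mass_insert_le _ _ _)

theorem Rule.inv_and_measure_lt {C : Finset Fml} (hC : IsRuleClosed C) {s : Sequent}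
    (h : s.Inv C) {n : ℕ} {c : Fin n → Sequent} {act : (Fin n → Vars) → Vars}
    (hr : Rule s n c act) : ∀ i, (c i).Inv C ∧ (c i).measure C < s.measure C := by
  have hrest : ∀ {χ π : Fml}, χ ∈ s.Γ \ {π} → χ ∈ (C : Set Fml) := fun hχ => h.sub hχ.1
  have hcomp : ∀ {π χ : Fml}, π ∈ s.Γ → χ ∈ ruleComps π → χ ∈ (C : Set Fml) :=
    fun hπ hχ => hC.comps _ (h.sub hπ) hχ
  cases hr with
  | id => exact fun i => i.elim0
  | diaStar₂ => exact fun i => i.elim0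
  | and φ ψ Γ hΓ hmem hNx =>
    subst hΓ
    refine Fin.forall_fin_one.2 (h.child_of_nx_none hNx hmem ?_ ?_)
    · rintro χ (hχ | hχ)
      exacts [hcomp hmem hχ, hrest hχ]
    · have h₁ := mass_insert_le C φ (insert ψ (s.Γ \ {.and φ ψ}))
      have h₂ := mass_insert_le C ψ (s.Γ \ {.and φ ψ})
      rw [Set.insert_union, Set.singleton_union, Fml.wt]; omega
  | boxUnion α β φ Γ hΓ hmem hNx =>
    subst hΓ
    refine Fin.forall_fin_one.2 (h.child_of_nx_none hNx hmem ?_ ?_)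
    · rintro χ (hχ | hχ)
      exacts [hcomp hmem hχ, hrest hχ]
    · have h₁ := mass_insert_le C (.box α φ)
        (insert (.box β φ) (s.Γ \ {.box (.union α β) φ}))
      have h₂ := mass_insert_le C (.box β φ) (s.Γ \ {.box (.union α β) φ})
      simp only [Fml.wt] at h₁ h₂
      rw [Set.insert_union, Set.singleton_union, Fml.wt, Prg.wt]; omega
  | boxSeq α β φ Γ hΓ hmem hNx =>
    subst hΓ
    refine Fin.forall_fin_one.2 (h.child_of_nx_none hNx hmem ?_ ?_)
    · rintro χ (hχ | hχ)
      exacts [hcomp hmem hχ, hrest hχ]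
    · have h₁ := mass_insert_le C (.box α (.box β φ)) (s.Γ \ {.box (.seq α β) φ})
      have h₂ := Fml.wt_boxSeq α β φ ∅
      rw [Set.singleton_union]; omega
  | boxStar α φ Γ hΓ hmem hNx =>
    subst hΓ
    refine Fin.forall_fin_one.2 ?_
    by_cases hBB : Fml.box (.star α) φ ∈ s.BB
    · simp only [Matrix.cons_val_zero, if_pos hBB]
      have hBB' : {Fml.box (.star α) φ} ∪ s.BB = s.BB := by simp [hBB]
      rw [hBB']
      refine h.child_of_nx_none hNx hmem (fun χ hχ => hrest hχ) ?_
      rw [Fml.wt, Prg.wt, if_neg (Set.notMem_empty _)]; omega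
    · simp only [Matrix.cons_val_zero, if_neg hBB]
      refine ⟨h.of_nx_none hNx rfl rfl rfl ?_,
        Sequent.measure_lt_of_BB rfl (h.sub hmem) hBB rfl⟩
      rintro χ (hχ | hχ)
      exacts [hcomp hmem hχ, hrest hχ]
  | diaSeq α β φ Γ hΓ hmem hNx =>
    subst hΓ
    refine Fin.forall_fin_one.2
      (h.child_of_reduct hmem hNx (Δ := s.Γ \ {.dia (.seq α β) φ}) (.inl rfl) ?_ ?_ ?_)
    · rw [Set.singleton_union]
    · rintro χ (hχ | hχ)
      exacts [hcomp hmem hχ, hrest hχ]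
    · simp only [Fml.wt, Prg.wt]; omega
  | diaTest ψ φ Γ hΓ hmem hNx =>
    subst hΓ
    refine Fin.forall_fin_one.2
      (h.child_of_reduct hmem hNx (Δ := insert ψ (s.Γ \ {.dia (.test ψ) φ}))
        (.inl (.inr rfl)) ?_ ?_ ?_)
    · rw [Set.insert_union, Set.singleton_union, Set.insert_comm]
    · rintro χ (hχ | hχ)
      · refine hcomp hmem ?_
        rw [Set.pair_comm] at hχ; exact hχ
      · exact hrest hχ
    · have h₁ := mass_insert_le C ψ (s.Γ \ {.dia (.test ψ) φ})
      rw [Fml.wt_dia, Prg.wt]; omega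
  | or φ ψ Γ hΓ hmem hNx =>
    subst hΓ
    refine Fin.forall_fin_two.2
      ⟨h.child_of_nx_none hNx hmem ?_ ?_, h.child_of_nx_none hNx hmem ?_ ?_⟩
    · rintro χ (rfl | hχ)
      exacts [hcomp hmem (.inl rfl), hrest hχ]
    · have h₁ := mass_insert_le C φ (s.Γ \ {.or φ ψ})
      rw [Set.singleton_union, Fml.wt]; omega
    · rintro χ (rfl | hχ)
      exacts [hcomp hmem (.inr rfl), hrest hχ]
    · have h₁ := mass_insert_le C ψ (s.Γ \ {.or φ ψ})
      rw [Set.singleton_union, Fml.wt]; omega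
  | boxTest ψ φ Γ hΓ hmem hNx =>
    subst hΓ
    refine Fin.forall_fin_two.2
      ⟨h.child_of_nx_none hNx hmem ?_ ?_, h.child_of_nx_none hNx hmem ?_ ?_⟩
    · rintro χ (rfl | hχ)
      exacts [hcomp hmem (.inr rfl), hrest hχ]
    · have h₁ := mass_insert_le C ψ.negNNF (s.Γ \ {.box (.test ψ) φ})
      rw [ψ.wt_negNNF] at h₁
      rw [Set.singleton_union, Fml.wt_box, Prg.wt]; omega
    · rintro χ (rfl | hχ)
      exacts [hcomp hmem (.inl rfl), hrest hχ]
    · have h₁ := mass_insert_le C φ (s.Γ \ {.box (.test ψ) φ})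
      rw [Set.singleton_union, Fml.wt_box, Prg.wt]; omega
  | diaUnion α β φ Γ hΓ hmem hNx =>
    subst hΓ
    refine Fin.forall_fin_two.2
      ⟨h.child_of_reduct hmem hNx (Δ := s.Γ \ {.dia (.union α β) φ}) (.inl rfl) ?_ ?_ ?_,
        h.child_of_reduct hmem hNx (Δ := s.Γ \ {.dia (.union α β) φ}) (.inl rfl) ?_ ?_ ?_⟩
    · rw [Set.singleton_union]
    · rintro χ (rfl | hχ)
      exacts [hcomp hmem (.inl rfl), hrest hχ]
    · simp only [Fml.wt, Prg.wt]; omega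
    · rw [Set.singleton_union]
    · rintro χ (rfl | hχ)
      exacts [hcomp hmem (.inr rfl), hrest hχ]
    · simp only [Fml.wt, Prg.wt]; omega
  | diaStar₁ α φ Γ hΓ hmem hNx hBD =>
    subst hΓ
    have h₁ := Fml.wt_diaStar_left hBD
    have h₂ := Fml.wt_diaStar_right hBD
    refine Fin.forall_fin_two.2
      ⟨h.child_of_reduct hmem hNx (Δ := s.Γ \ {.dia (.star α) φ}) (.inl rfl) ?_ ?_ (by omega),
        h.child_of_reduct hmem hNx (Δ := s.Γ \ {.dia (.star α) φ}) (.inl rfl) ?_ ?_ (by omega)⟩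
    · rw [Set.singleton_union]
    · rintro χ (rfl | hχ)
      exacts [hcomp hmem (.inl rfl), hrest hχ]
    · rw [Set.singleton_union]
    · rintro χ (rfl | hχ)
      exacts [hcomp hmem (.inr rfl), hrest hχ]
  | dia _ f lvl hform hcons hinj hf hlvl =>
    intro i
    obtain ⟨hmem, hnew⟩ := (hf _ _).1 ⟨i, rfl⟩
    have hsub : insert (f i).2 (boxArgs (f i).1 s.Γ) ⊆ C := by
      rintro χ (rfl | hχ)
      · exact hcomp hmem rfl
      · exact hcomp hχ rfl
    have hinv : (coreSequent s (f i).1 (f i).2).Inv C := by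
      refine ⟨hsub, fun π hπ => ?_, fun _ => rfl, ?_, ?_⟩
      · obtain ⟨h₁, h₂⟩ := tst_eq_some hπ
        exact ⟨.inl h₁.symm, h₂⟩
      -- Only unblocked diamonds get a child, so the appended pair is new.
      · exact h.nodup.append (List.nodup_singleton _) (by simpa using hnew)
      · intro e he
        rcases List.mem_append.1 he with he | he
        · exact h.hcr e he
        · rw [List.mem_singleton] at he
          subst he
          exact ⟨hcomp hmem rfl, hsub⟩
    exact ⟨hinv, Sequent.measure_lt_of_hcr (by simp [coreSequent]) hinv.length_le⟩

/-- Literals and formulae `⟨a⟩φ`, `[a]φ` with atomic `a`. -/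
def Fml.IsSimple (χ : Fml) : Prop :=
  (∃ p, χ = .atom p) ∨ (∃ p, χ = .neg (.atom p)) ∨
    (∃ a φ, χ = .dia (.atom a) φ) ∨ (∃ a φ, χ = .box (.atom a) φ)

/-- Only literals and formulae `⟨a⟩φ`, `[a]φ` with atomic `a` occur in `Γ`. -/
def Saturated (Γ : Set Fml) : Prop := ∀ χ ∈ Γ, χ.IsSimple

/-- A prescribed formula is a complex diamond of the node and can be reduced. With nothing
prescribed, either there is a clash, or all formulae are simple and the existential rule applies, or
some formula can be decomposed; negation normal form excludes all other negations. -/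
theorem Sequent.Inv.ruleApplicable {C : Finset Fml} (hC : IsRuleClosed C) {s : Sequent}
    (h : s.Inv C) : RuleApplicable s := by
  classical
  have hdia : ∀ α φ, (∀ a, α ≠ Prg.atom a) → Fml.dia α φ ∈ s.Γ →
      (s.Nx = none ∨ s.Nx = some (.dia α φ)) → RuleApplicable s := by
    intro α φ hα hmem hNx
    cases α with
    | atom a => exact absurd rfl (hα a)
    | test ψ => exact ⟨_, _, _, .diaTest ψ φ _ rfl hmem hNx⟩
    | seq α β => exact ⟨_, _, _, .diaSeq α β φ _ rfl hmem hNx⟩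
    | union α β => exact ⟨_, _, _, .diaUnion α β φ _ rfl hmem hNx⟩
    | star α =>
      by_cases hBD : Fml.dia (.star α) φ ∈ s.BD
      · exact ⟨_, _, _, .diaStar₂ α φ hmem hNx hBD⟩
      · exact ⟨_, _, _, .diaStar₁ α φ _ rfl hmem hNx hBD⟩
  rcases hNx : s.Nx with _ | π
  swap
  · obtain ⟨hπ, α, φ, rfl, hα⟩ := h.nx π hNx
    exact hdia α φ hα hπ (.inr hNx)
  by_cases hid : ∃ p, Fml.atom p ∈ s.Γ ∧ Fml.neg (.atom p) ∈ s.Γ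
  · obtain ⟨p, h₁, h₂⟩ := hid
    exact ⟨_, _, _, .id p h₁ h₂⟩
  by_cases hsat : Saturated s.Γ
  -- The existential rule needs a finite enumeration of the unblocked diamonds; it exists since
  -- these diamonds lie in `C`.
  · let D : Set (ℕ × Fml) := {x | Fml.dia (.atom x.1) x.2 ∈ s.Γ ∧ corePair s.Γ x.1 x.2 ∉ s.HCr}
    have hD : Finite D := by
      refine Set.Finite.to_subtype ?_
      refine Set.Finite.of_finite_image (f := fun x : ℕ × Fml => Fml.dia (.atom x.1) x.2)
        (C.finite_toSet.subset ?_) ?_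
      · rintro _ ⟨x, hx, rfl⟩
        exact h.sub hx.1
      · rintro ⟨a, φ⟩ - ⟨b, ψ⟩ - hab
        simpa using hab
    have hlvl : ∀ (a : ℕ) (φ : Fml), ∃ j : ℕ, Fml.dia (.atom a) φ ∈ s.Γ → corePair s.Γ a φ ∈ s.HCr →
        s.HCr[j]? = some (corePair s.Γ a φ) := by
      intro a φ
      by_cases hm : corePair s.Γ a φ ∈ s.HCr
      · obtain ⟨j, hj⟩ := List.mem_iff_getElem?.1 hm
        exact ⟨j, fun _ _ => hj⟩
      · exact ⟨0, fun _ h => absurd h hm⟩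
    choose lvl hlvl using hlvl
    let e := (Finite.equivFin D).symm
    refine ⟨_, _, _, .dia _ (fun i => (e i).1) lvl hsat (fun p hp => hid ⟨p, hp⟩)
      (Subtype.val_injective.comp e.injective) (fun a φ => ⟨?_, fun hm => ?_⟩) hlvl⟩
    · rintro ⟨i, hi⟩
      have := (e i).2
      rw [hi] at this
      exact this
    · exact ⟨e.symm ⟨(a, φ), hm⟩, congrArg Subtype.val (e.apply_symm_apply _)⟩
  · unfold Saturated Fml.IsSimple at hsat
    push Not at hsat
    obtain ⟨χ, hχ, h₁, h₂, h₃, h₄⟩ := hsat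
    have hnnf := hC.isNNF χ (h.sub hχ)
    cases χ with
    | atom p => exact absurd rfl (h₁ p)
    | neg ψ =>
      cases ψ with
      | atom p => exact absurd rfl (h₂ p)
      | _ => simp [Fml.IsNNF] at hnnf
    | and φ ψ => exact ⟨_, _, _, .and φ ψ _ rfl hχ hNx⟩
    | or φ ψ => exact ⟨_, _, _, .or φ ψ _ rfl hχ hNx⟩
    | dia α φ => exact hdia α φ (by rintro a rfl; exact h₃ a φ rfl) hχ (.inl hNx)
    | box α φ =>
      cases α with
      | atom a => exact absurd rfl (h₄ a φ)
      | test ψ => exact ⟨_, _, _, .boxTest ψ φ _ rfl hχ hNx⟩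
      | seq α β => exact ⟨_, _, _, .boxSeq α β φ _ rfl hχ hNx⟩
      | union α β => exact ⟨_, _, _, .boxUnion α β φ _ rfl hχ hNx⟩
      | star α => exact ⟨_, _, _, .boxStar α φ _ rfl hχ hNx⟩

/-! ### The formulae `⟨α₁⟩ … ⟨αₖ⟩φ` -/

theorem self_mem_pre (φ : Fml) : φ ∈ pre φ := ⟨[], rfl⟩

theorem dia_mem_pre {φ χ : Fml} (β : Prg) (h : χ ∈ pre φ) : Fml.dia β χ ∈ pre φ := by
  obtain ⟨l, rfl⟩ := h
  exact ⟨β :: l, rfl⟩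

theorem eq_or_mem_pre {φ χ : Fml} {β : Prg} (h : Fml.dia β χ ∈ pre φ) :
    Fml.dia β χ = φ ∨ χ ∈ pre φ := by
  obtain ⟨l, hl⟩ := h
  cases l with
  | nil => exact .inl hl
  | cons γ l =>
    simp only [List.foldr_cons, Fml.dia.injEq] at hl
    exact .inr ⟨l, hl.2⟩

theorem exists_eq_dia_of_mem_pre {α : Prg} {φ χ : Fml} (h : χ ∈ pre (.dia α φ)) :
    ∃ β ξ, χ = .dia β ξ := by
  obtain ⟨l, rfl⟩ := h
  cases l <;> exact ⟨_, _, rfl⟩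

theorem pre_dia_subset (α : Prg) (φ : Fml) : pre (.dia α φ) ⊆ pre φ := by
  rintro _ ⟨l, rfl⟩
  exact ⟨l ++ [α], by simp⟩

/-- By size. This gives the requirement that a fulfilling chain does not meet `φ` before its end. -/
theorem ne_of_mem_pre_dia {α : Prg} {φ χ : Fml} (h : χ ∈ pre (.dia α φ)) : χ ≠ φ := by
  obtain ⟨l, rfl⟩ := h
  have h : sizeOf φ < sizeOf (l.foldr Fml.dia (.dia α φ)) := by
    induction l with
    | nil => simp
    | cons β l ih => simp only [List.foldr_cons, Fml.dia.sizeOf_spec]; omega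
  intro h'
  rw [h'] at h
  exact lt_irrefl _ h

theorem mem_pre_of_dia_atom {α : Prg} {φ χ : Fml} {a : ℕ}
    (h : Fml.dia (.atom a) χ ∈ pre (.dia (.star α) φ)) : χ ∈ pre (.dia (.star α) φ) := by
  rcases eq_or_mem_pre h with h | h
  · simp at h
  · exact h

/-! ### The rules other than the existential one -/

/-- What happens to the formulae and histories if a rule other than the existential one
leads from `s` to `s'`. -/
structure LocalStep (s s' : Sequent) : Prop where
  hcr : s'.HCr = s.HCr
  bb : ∀ χ ∈ s'.BB, χ ∈ s.BB ∨ ∀ S, Alpha χ S → S ⊆ s'.Γ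
  alpha : ∀ χ ∈ s.Γ, χ ∈ s'.Γ ∨ ∀ S, Alpha χ S → S ⊆ s'.Γ ∨ (χ ∈ s.BB ∧ χ ∉ FmlDia)
  beta : ∀ χ ∈ s.Γ, χ ∈ s'.Γ ∨ ∀ χ₁ χ₂, Beta χ χ₁ χ₂ → χ₁ ∈ s'.Γ ∨ χ₂ ∈ s'.Γ
  simple : ∀ χ ∈ s.Γ, χ.IsSimple → χ ∈ s'.Γ

theorem LocalStep.of_principal {s s' : Sequent} {π : Fml} (hcr : s'.HCr = s.HCr)
    (bb : ∀ χ ∈ s'.BB, χ ∈ s.BB ∨ ∀ S, Alpha χ S → S ⊆ s'.Γ) (hΓ : s.Γ \ {π} ⊆ s'.Γ)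
    (hπ : ¬ π.IsSimple)
    (alpha : ∀ S, Alpha π S → S ⊆ s'.Γ ∨ (π ∈ s.BB ∧ π ∉ FmlDia))
    (beta : ∀ χ₁ χ₂, Beta π χ₁ χ₂ → χ₁ ∈ s'.Γ ∨ χ₂ ∈ s'.Γ) : LocalStep s s' where
  hcr := hcr
  bb := bb
  alpha χ hχ := by
    by_cases h : χ = π
    · exact .inr (h ▸ alpha)
    · exact .inl (hΓ ⟨hχ, h⟩)
  beta χ hχ := by
    by_cases h : χ = π
    · exact .inr (h ▸ beta)
    · exact .inl (hΓ ⟨hχ, h⟩)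
  simple χ hχ hs := hΓ ⟨hχ, fun h => hπ (h ▸ hs)⟩

theorem Rule.localStep {s : Sequent} {n : ℕ} {c : Fin n → Sequent}
    {act : (Fin n → Vars) → Vars} (hr : Rule s n c act) (hsat : ¬ Saturated s.Γ) :
    ∀ i, LocalStep s (c i) := by
  cases hr with
  | id => exact fun i => i.elim0
  | diaStar₂ => exact fun i => i.elim0
  | dia _ f lvl hform => exact absurd hform hsat
  | boxStar α φ Γ hΓ hmem hNx =>
    subst hΓ
    refine Fin.forall_fin_one.2 ?_
    by_cases hBB : Fml.box (.star α) φ ∈ s.BB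
    · refine .of_principal (π := .box (.star α) φ) rfl ?_ ?_ (by simp [Fml.IsSimple]) ?_ ?_
      · rintro χ (rfl | hχ)
        exacts [.inl hBB, .inl hχ]
      · simp [hBB]
      -- The box is dropped without its components; `BB` records that they were added before.
      · exact fun S _ => .inr ⟨hBB, by simp [FmlDia]⟩
      · intro _ _ h; cases h
    · refine .of_principal (π := .box (.star α) φ) rfl ?_ ?_ (by simp [Fml.IsSimple]) ?_ ?_
      · rintro χ (rfl | hχ)
        · refine .inr fun S hS => ?_
          cases hS
          simp only [Matrix.cons_val_zero, if_neg hBB]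
          exact Set.subset_union_left
        · exact .inl hχ
      · simp only [Matrix.cons_val_zero, if_neg hBB]
        exact Set.subset_union_right
      · intro S hS
        cases hS
        simp only [Matrix.cons_val_zero, if_neg hBB]
        exact .inl Set.subset_union_left
      · intro _ _ h; cases h
  | and φ ψ Γ hΓ hmem hNx | boxUnion α β φ Γ hΓ hmem hNx | boxSeq α β φ Γ hΓ hmem hNx
  | diaSeq α β φ Γ hΓ hmem hNx =>
    subst hΓ
    refine Fin.forall_fin_one.2
      (.of_principal rfl (fun _ => .inl) Set.subset_union_right (by simp [Fml.IsSimple]) ?_ ?_)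
    · intro S hS
      cases hS
      exact .inl Set.subset_union_left
    · intro _ _ h; cases h
  | diaTest ψ φ Γ hΓ hmem hNx =>
    subst hΓ
    refine Fin.forall_fin_one.2
      (.of_principal rfl (fun _ => .inl) Set.subset_union_right (by simp [Fml.IsSimple]) ?_ ?_)
    · intro S hS
      cases hS
      rw [Set.pair_comm]
      exact .inl Set.subset_union_left
    · intro _ _ h; cases h
  | or φ ψ Γ hΓ hmem hNx | boxTest ψ φ Γ hΓ hmem hNx | diaUnion α β φ Γ hΓ hmem hNx
  | diaStar₁ α φ Γ hΓ hmem hNx hBD =>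
    subst hΓ
    refine Fin.forall_fin_two.2 ⟨?_, ?_⟩
    all_goals
      refine .of_principal rfl (fun _ => .inl) Set.subset_union_right
        (by simp [Fml.IsSimple]) ?_ ?_
      · intro S hS; cases hS
      · intro χ₁ χ₂ h
        cases h
        simp

-- Pursuing an eventuality through the local rules

/-- An undefined value acts as a least element, so the pointwise minimum is always the value of one
of the two open children. -/
theorem betaVars_opened {s₁ s₂ : Status} {u₁ u₂ : Uev}
    (h : (betaVars s₁ s₂ u₁ u₂).stat = .opened) (χ₁ χ₂ : Fml) :
    (s₁ = .opened ∧ (betaVars s₁ s₂ u₁ u₂).uev χ₁ χ₂ = u₁ χ₁ χ₂) ∨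
      (s₂ = .opened ∧ (betaVars s₁ s₂ u₁ u₂).uev χ₁ χ₂ = u₂ χ₁ χ₂) := by
  cases s₁ <;> cases s₂ <;> simp [betaVars, betaStat] at h ⊢
  unfold uevMin
  rcases u₁ χ₁ χ₂ with _ | m <;> rcases u₂ χ₁ χ₂ with _ | n <;> simp
  exact le_total m n

/-- `s'` and `u` continue the pursuit of the eventuality `⟨α*⟩φ` at `χ`, whose value is `val`. -/
def Tracks (α : Prg) (φ χ : Fml) (val : Option ℕ+) (s' : Sequent) (u : Uev) : Prop :=
  (χ = .dia (.star α) φ ∧ φ ∈ s'.Γ) ∨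
    ∃ χ' ∈ s'.Γ, χ' ∈ pre (.dia (.star α) φ) ∧ (χ' = χ ∨ Reduces χ χ') ∧
      val = u χ' (.dia (.star α) φ)

section Tracks
variable {α : Prg} {φ χ : Fml} {s s' : Sequent}

theorem tracks_keep (hpre : χ ∈ pre (.dia (.star α) φ)) (hχ : χ ∈ s.Γ) {π : Fml}
    (hπ : π ∉ FmlDia) (u : Uev) (hΓ : s.Γ \ {π} ⊆ s'.Γ) :
    Tracks α φ χ (uevKeep (s.Γ \ {π}) u χ (.dia (.star α) φ)) s' u := by
  have hmem : χ ∈ s.Γ \ {π} := ⟨hχ, by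
    rintro rfl
    obtain ⟨β, ξ, rfl⟩ := exists_eq_dia_of_mem_pre hpre
    exact hπ ⟨_, _, rfl⟩⟩
  exact .inr ⟨χ, hΓ hmem, hpre, .inl rfl, if_pos hmem⟩

theorem tracks_pull (hpre : χ ∈ pre (.dia (.star α) φ)) (hχ : χ ∈ s.Γ) {π ρ : Fml}
    (hred : Reduces π ρ) (hρ : π ∈ pre (.dia (.star α) φ) → ρ ∈ pre (.dia (.star α) φ))
    (u : Uev) (hmem : ρ ∈ s'.Γ) (hΓ : s.Γ \ {π} ⊆ s'.Γ) :
    Tracks α φ χ (uevPull π ρ (s.Γ \ {π}) u χ (.dia (.star α) φ)) s' u := by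
  by_cases h : χ = π
  · subst h
    exact .inr ⟨ρ, hmem, hρ hpre, .inr hred, if_pos rfl⟩
  · have hm : χ ∈ s.Γ \ {π} := ⟨hχ, h⟩
    exact .inr ⟨χ, hΓ hm, hpre, .inl rfl, by rw [uevPull, if_neg h, if_pos hm]⟩

/-- The value is erased only for the pair of the starred diamond with itself, and there the first
branch fulfils the eventuality. A different starred diamond on the way to the eventuality is an
ordinary reduction. -/
theorem tracks_fulfil (hpre : χ ∈ pre (.dia (.star α) φ)) (hχ : χ ∈ s.Γ) {β : Prg} {ξ : Fml}
    (u : Uev) (hmem : ξ ∈ s'.Γ) (hΓ : s.Γ \ {.dia (.star β) ξ} ⊆ s'.Γ) :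
    Tracks α φ χ (uevFulfil (.dia (.star β) ξ) ξ (s.Γ \ {.dia (.star β) ξ}) u χ
      (.dia (.star α) φ)) s' u := by
  by_cases h : Fml.dia (.star β) ξ = .dia (.star α) φ
  · by_cases h' : χ = .dia (.star β) ξ
    · obtain ⟨-, rfl⟩ : Prg.star β = .star α ∧ ξ = φ := by simpa using h
      exact .inl ⟨h'.trans h, hmem⟩
    · rw [uevFulfil, if_neg fun h => h' h.1]
      have hm : χ ∈ s.Γ \ {Fml.dia (.star β) ξ} := ⟨hχ, h'⟩
      exact .inr ⟨χ, hΓ hm, hpre, .inl rfl, by rw [uevPull, if_neg h', if_pos hm]⟩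
  · rw [uevFulfil, if_neg fun h' => h h'.2.symm]
    exact tracks_pull hpre hχ (.starStop β ξ) (fun hp => (eq_or_mem_pre hp).resolve_left h)
      u hmem hΓ

theorem Tracks.of_beta {v : Fin 2 → Vars} {c : Fin 2 → Sequent} {u₁ u₂ : Uev}
    (hopen : (betaVars (v 0).stat (v 1).stat u₁ u₂).stat = .opened)
    (h₁ : Tracks α φ χ (u₁ χ (.dia (.star α) φ)) (c 0) (v 0).uev)
    (h₂ : Tracks α φ χ (u₂ χ (.dia (.star α) φ)) (c 1) (v 1).uev) :
    ∃ i, (v i).stat = .opened ∧ Tracks α φ χ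
      ((betaVars (v 0).stat (v 1).stat u₁ u₂).uev χ (.dia (.star α) φ)) (c i) (v i).uev := by
  rcases betaVars_opened hopen χ (.dia (.star α) φ) with ⟨h, h'⟩ | ⟨h, h'⟩
  · exact ⟨0, h, h' ▸ h₁⟩
  · exact ⟨1, h, h' ▸ h₂⟩

/-- The child depends on the eventuality: at a branching it is an open one that supplies the value
of the parent. -/
theorem Rule.exists_tracks {n : ℕ} {c : Fin n → Sequent} {act : (Fin n → Vars) → Vars}
    (hr : Rule s n c act) (hsat : ¬ Saturated s.Γ) {v : Fin n → Vars}
    (hopen : (act v).stat = .opened) (hχ : χ ∈ s.Γ) (hpre : χ ∈ pre (.dia (.star α) φ)) :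
    ∃ i, (v i).stat = .opened ∧
      Tracks α φ χ ((act v).uev χ (.dia (.star α) φ)) (c i) (v i).uev := by
  cases hr with
  | id => cases hopen
  | diaStar₂ => cases hopen
  | dia _ f lvl hform => exact absurd hform hsat
  | and _ _ Γ hΓ | boxUnion _ _ _ Γ hΓ | boxSeq _ _ _ Γ hΓ =>
    subst hΓ
    exact ⟨0, hopen, tracks_keep hpre hχ (by simp [FmlDia]) _ Set.subset_union_right⟩
  | boxStar _ _ Γ hΓ =>
    subst hΓ
    refine ⟨0, hopen, tracks_keep hpre hχ (by simp [FmlDia]) _ ?_⟩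
    simp only [Matrix.cons_val_zero]
    split
    exacts [subset_rfl, Set.subset_union_right]
  | diaSeq β γ ξ Γ hΓ =>
    subst hΓ
    refine ⟨0, hopen, tracks_pull hpre hχ (.seq β γ ξ) (fun hp => ?_) _ (.inl rfl)
      Set.subset_union_right⟩
    exact dia_mem_pre _ (dia_mem_pre _ ((eq_or_mem_pre hp).resolve_left (by simp)))
  | diaTest ψ ξ Γ hΓ =>
    subst hΓ
    exact ⟨0, hopen, tracks_pull hpre hχ (.test ψ ξ)
      (fun hp => (eq_or_mem_pre hp).resolve_left (by simp)) _ (.inl (.inr rfl))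
      Set.subset_union_right⟩
  | or _ _ Γ hΓ | boxTest _ _ Γ hΓ =>
    subst hΓ
    exact Tracks.of_beta hopen
      (tracks_keep hpre hχ (by simp [FmlDia]) _ Set.subset_union_right)
      (tracks_keep hpre hχ (by simp [FmlDia]) _ Set.subset_union_right)
  | diaUnion β γ ξ Γ hΓ =>
    subst hΓ
    exact Tracks.of_beta hopen
      (tracks_pull hpre hχ (.unionLeft β γ ξ)
        (fun hp => dia_mem_pre _ ((eq_or_mem_pre hp).resolve_left (by simp))) _ (.inl rfl)
        Set.subset_union_right)
      (tracks_pull hpre hχ (.unionRight β γ ξ)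
        (fun hp => dia_mem_pre _ ((eq_or_mem_pre hp).resolve_left (by simp))) _ (.inl rfl)
        Set.subset_union_right)
  | diaStar₁ β ξ Γ hΓ =>
    subst hΓ
    exact Tracks.of_beta hopen
      (tracks_fulfil hpre hχ _ (.inl rfl) Set.subset_union_right)
      (tracks_pull hpre hχ (.starStep β ξ) (fun hp => dia_mem_pre _ hp) _ (.inl rfl)
        Set.subset_union_right)

theorem Rule.exists_opened {n : ℕ} {c : Fin n → Sequent} {act : (Fin n → Vars) → Vars}
    (hr : Rule s n c act) (hsat : ¬ Saturated s.Γ) {v : Fin n → Vars}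
    (hopen : (act v).stat = .opened) : ∃ i, (v i).stat = .opened := by
  cases hr with
  | id => cases hopen
  | diaStar₂ => cases hopen
  | dia _ f lvl hform => exact absurd hform hsat
  | or φ | boxTest _ φ | diaUnion _ _ φ | diaStar₁ _ φ =>
    rcases betaVars_opened hopen φ φ with h | h
    exacts [⟨0, h.1⟩, ⟨1, h.1⟩]
  | _ => exact ⟨0, hopen⟩

end Tracks

/-- Here the child is prescribed, in contrast to `Rule.exists_tracks`; nothing is claimed about
`uev`, only that the pursuit survives the step or is fulfilled. -/
theorem LocalStep.follow {s s' : Sequent} (h : LocalStep s s') {α : Prg} {φ χ : Fml}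
    (hχ : χ ∈ s.Γ) (hpre : χ ∈ pre (.dia (.star α) φ)) :
    (χ = .dia (.star α) φ ∧ φ ∈ s'.Γ) ∨
      ∃ χ' ∈ s'.Γ, χ' ∈ pre (.dia (.star α) φ) ∧ (χ' = χ ∨ Reduces χ χ') := by
  by_cases hχ' : χ ∈ s'.Γ
  · exact .inr ⟨χ, hχ', hpre, .inl rfl⟩
  have ha := (h.alpha χ hχ).resolve_left hχ'
  have hb := (h.beta χ hχ).resolve_left hχ'
  have hs := mt (h.simple χ hχ) hχ'
  obtain ⟨β, ξ, rfl⟩ := exists_eq_dia_of_mem_pre hpre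
  have ha' : ∀ S, Alpha (.dia β ξ) S → S ⊆ s'.Γ := fun S hS =>
    (ha S hS).resolve_right fun h => h.2 ⟨_, _, rfl⟩
  cases β with
  | atom a => exact absurd (.inr (.inr (.inl ⟨a, ξ, rfl⟩))) hs
  | test ψ =>
    exact .inr ⟨ξ, ha' _ (.diaTest ψ ξ) (.inl rfl),
      (eq_or_mem_pre hpre).resolve_left (by simp), .inr (.test ψ ξ)⟩
  | seq β γ =>
    exact .inr ⟨_, ha' _ (.diaSeq β γ ξ) rfl,
      dia_mem_pre _ (dia_mem_pre _ ((eq_or_mem_pre hpre).resolve_left (by simp))),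
      .inr (.seq β γ ξ)⟩
  | union β γ =>
    have hξ := (eq_or_mem_pre hpre).resolve_left (by simp)
    rcases hb _ _ (.diaUnion β γ ξ) with h | h
    · exact .inr ⟨_, h, dia_mem_pre _ hξ, .inr (.unionLeft β γ ξ)⟩
    · exact .inr ⟨_, h, dia_mem_pre _ hξ, .inr (.unionRight β γ ξ)⟩
  | star β =>
    rcases hb _ _ (.diaStar β ξ) with h | h
    · rcases eq_or_mem_pre hpre with h' | h'
      · simp only [Fml.dia.injEq, Prg.star.injEq] at h'
        obtain ⟨rfl, rfl⟩ := h'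
        exact .inl ⟨rfl, h⟩
      · exact .inr ⟨_, h, h', .inr (.starStop β ξ)⟩
    · exact .inr ⟨_, h, dia_mem_pre _ hpre, .inr (.starStep β ξ)⟩

/-! ### The existential rule -/

/-- What is known about a node with sequent `s` and variables `w` to which the existential rule
has been applied, if it is open. -/
structure DiaStep (s : Sequent) (w : Vars) {n : ℕ} (c : Fin n → Sequent) (v : Fin n → Vars) :
    Prop where
  consistent : ∀ p, ¬ (Fml.atom p ∈ s.Γ ∧ Fml.neg (.atom p) ∈ s.Γ)
  child : ∀ i, (v i).stat = .opened ∧ ∃ a χ, Fml.dia (.atom a) χ ∈ s.Γ ∧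
    c i = coreSequent s a χ ∧ ∀ ψ ∈ FmlDiaStar, χ ∈ pre ψ →
      ∀ m, (v i).uev χ ψ = some m → (m : ℕ) ≤ s.HCr.length
  dia : ∀ a χ, Fml.dia (.atom a) χ ∈ s.Γ →
    (∃ i, c i = coreSequent s a χ ∧ ∀ ψ ∈ FmlDiaStar, Fml.dia (.atom a) χ ∈ pre ψ →
      w.uev (.dia (.atom a) χ) ψ = (v i).uev χ ψ) ∨
    ∃ j : ℕ, s.HCr[j]? = some (corePair s.Γ a χ) ∧ ∀ ψ ∈ FmlDiaStar,
      Fml.dia (.atom a) χ ∈ pre ψ → w.uev (.dia (.atom a) χ) ψ = some j.succPNat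

theorem Rule.diaStep {s : Sequent} {n : ℕ} {c : Fin n → Sequent}
    {act : (Fin n → Vars) → Vars} (hr : Rule s n c act) (hsat : Saturated s.Γ)
    {v : Fin n → Vars} (hopen : (act v).stat = .opened) : DiaStep s (act v) c v := by
  cases hr with
  | id => cases hopen
  | diaStar₂ => cases hopen
  | dia _ f lvl hform hcons hinj hf hlvl =>
    classical
    have hst := hopen
    simp only [diaStat] at hst
    split at hst
    · cases hst
    rename_i hno
    push Not at hno
    refine ⟨hcons, fun i => ⟨(hno i).1, (f i).1, (f i).2, ((hf _ _).1 ⟨i, rfl⟩).1, rfl,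
      (hno i).2⟩, fun a χ hχ => ?_⟩
    have huev : ∀ ψ ∈ FmlDiaStar, Fml.dia (.atom a) χ ∈ pre ψ →
        diaUev s.Γ (diaStat s.HCr.length f v) f lvl v (.dia (.atom a) χ) ψ =
          if h : ∃ i, f i = (a, χ) then (v h.choose).uev χ ψ
          else some (lvl a χ).succPNat :=
      fun ψ h₁ h₂ => if_pos ⟨hopen, h₁, h₂, hχ⟩
    by_cases hm : corePair s.Γ a χ ∈ s.HCr
    · refine .inr ⟨lvl a χ, hlvl a χ hχ hm, fun ψ h₁ h₂ => ?_⟩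
      exact (huev ψ h₁ h₂).trans (dif_neg fun h => ((hf a χ).1 h).2 hm)
    · have h := (hf a χ).2 ⟨hχ, hm⟩
      refine .inl ⟨h.choose, ?_, fun ψ h₁ h₂ => (huev ψ h₁ h₂).trans (dif_pos h)⟩
      rw [h.choose_spec]
  | and _ _ _ _ hmem | boxUnion _ _ _ _ _ hmem | boxSeq _ _ _ _ _ hmem | boxStar _ _ _ _ hmem
  | diaSeq _ _ _ _ _ hmem | diaTest _ _ _ _ hmem | or _ _ _ _ hmem | boxTest _ _ _ _ hmem
  | diaUnion _ _ _ _ _ hmem | diaStar₁ _ _ _ _ hmem =>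
    exact absurd (hsat _ hmem) (by simp [Fml.IsSimple])

/-! ### Tableaux in which all rules have been applied -/

/-- A tableau in which a rule has been applied to each node and which has no infinite branch. -/
structure NodeTree.IsComplete (T : NodeTree) : Prop where
  hcr_root : (T.label []).seq.HCr = []
  bb_root : (T.label []).seq.BB = ∅
  rule : ∀ x, T.Mem x → T.RuleAppliedAt x
  induction : ∀ P : List ℕ → Prop,
    (∀ x, T.Mem x → (∀ i < T.arity x, P (i :: x)) → P x) → ∀ x, T.Mem x → P x

theorem NodeTree.IsTableau.isComplete {T : NodeTree} {φ : Fml} (hφ : φ.IsNNF)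
    (hT : T.IsTableau ⟨{φ}, [], none, ∅, ∅⟩) (hexp : T.IsExpanded) : T.IsComplete := by
  have hfin : (φ.cl ∪ Fml.negNNF '' φ.cl).Finite := φ.cl_finite.union (φ.cl_finite.image _)
  have hC := isRuleClosed_cl hφ
  obtain ⟨C, hCeq⟩ := hfin.exists_finset_coe
  rw [← hCeq] at hC
  have happ : ∀ x, T.Mem x → (T.label x).seq.Inv C → T.RuleAppliedAt x := by
    intro x hx hinv
    by_cases h : T.arity x = 0
    -- A leaf to which no rule is applicable cannot occur under the invariant.
    · exact (hexp x hx h).resolve_right fun h => h (hinv.ruleApplicable hC)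
    · exact hT.rule x hx h
  have hstep : ∀ x, T.Mem x → (T.label x).seq.Inv C → ∀ i < T.arity x,
      (T.label (i :: x)).seq.Inv C ∧
        (T.label (i :: x)).seq.measure C < (T.label x).seq.measure C := by
    intro x hx hinv i hi
    obtain ⟨c, act, hr, hc, -⟩ := happ x hx hinv
    have := hr.inv_and_measure_lt hC hinv ⟨i, hi⟩
    rwa [← hc ⟨i, hi⟩] at this
  have hinv : ∀ x, T.Mem x → (T.label x).seq.Inv C := by
    intro x hx
    induction hx with
    | root =>
      rw [hT.root]
      refine ⟨?_, by simp, fun _ => rfl, List.nodup_nil, by simp⟩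
      rintro _ rfl
      rw [hCeq]
      exact .inl (Fml.self_mem_cl _)
    | child x i hx hi ih => exact (hstep x hx ih i hi).1
  refine ⟨by rw [hT.root], by rw [hT.root], fun x hx => happ x hx (hinv x hx), fun P hP x hx => ?_⟩
  generalize hm : (T.label x).seq.measure C = m
  induction m using WellFoundedLT.induction generalizing x with
  | ind m ih =>
    refine hP x hx fun i hi => ?_
    exact ih _ (hm ▸ (hstep x hx (hinv x hx) i hi).2) _ (.child x i hx hi) rfl

-- The Hintikka structure of an open tableau: conditions H1 to H5

namespace NodeTree

/-- The formulae of the node with address `x`. -/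
abbrev fmls (T : NodeTree) (x : List ℕ) : Set Fml := (T.label x).seq.Γ

/-- The nodes that are open together with all their ancestors. -/
inductive Open (T : NodeTree) : List ℕ → Prop
  | root : (T.label []).vars.stat = .opened → T.Open []
  | child (x : List ℕ) (i : ℕ) : T.Open x → i < T.arity x →
      (T.label (i :: x)).vars.stat = .opened → T.Open (i :: x)

theorem Open.mem {T : NodeTree} {x : List ℕ} (h : T.Open x) : T.Mem x := by
  induction h with
  | root => exact .root
  | child x i _ hi _ ih => exact .child x i ih hi

theorem Open.stat {T : NodeTree} {x : List ℕ} (h : T.Open x) :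
    (T.label x).vars.stat = .opened := by
  cases h with
  | root h => exact h
  | child _ _ _ _ h => exact h

/-- `y` is an open child of the open node `x`, to which a rule other than the existential one has
been applied. -/
inductive Local (T : NodeTree) (x : List ℕ) : List ℕ → Prop
  | intro (i : ℕ) : ¬ Saturated (T.fmls x) → i < T.arity x → T.Open (i :: x) →
      T.Local x (i :: x)

/-- `y` is reached from `x` through open nodes without the use of the existential rule. -/
abbrev Segment (T : NodeTree) : List ℕ → List ℕ → Prop := Relation.ReflTransGen T.Local

variable {T : NodeTree}

theorem IsComplete.localStep (hT : T.IsComplete) {x y : List ℕ} (hx : T.Open x)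
    (h : T.Local x y) : LocalStep (T.label x).seq (T.label y).seq := by
  obtain ⟨i, hsat, hi, -⟩ := h
  obtain ⟨c, act, hr, hc, -⟩ := hT.rule x hx.mem
  rw [hc ⟨i, hi⟩]
  exact hr.localStep hsat _

theorem Local.open {x y : List ℕ} (h : T.Local x y) : T.Open y := by
  obtain ⟨i, -, -, h⟩ := h
  exact h

theorem Segment.simple (hT : T.IsComplete) {x y : List ℕ} (hx : T.Open x) (h : T.Segment x y)
    {χ : Fml} (hs : χ.IsSimple) (hχ : χ ∈ T.fmls x) : χ ∈ T.fmls y := by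
  induction h using Relation.ReflTransGen.head_induction_on with
  | refl => exact hχ
  | head hxy _ ih => exact ih hxy.open ((hT.localStep hx hxy).simple χ hχ hs)

/-- The worlds of the Hintikka structure. -/
abbrev World (T : NodeTree) : Type := {w : List ℕ // T.Open w ∧ Saturated (T.fmls w)}

theorem IsComplete.exists_world (hT : T.IsComplete) {x : List ℕ} (hx : T.Open x) :
    ∃ w : T.World, T.Segment x w := by
  refine hT.induction (fun x => T.Open x → ∃ w : T.World, T.Segment x w) ?_ x hx.mem hx
  intro x hmem ih hx
  by_cases hsat : Saturated (T.fmls x)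
  · exact ⟨⟨x, hx, hsat⟩, .refl⟩
  · obtain ⟨c, act, hr, hc, hv⟩ := hT.rule x hmem
    have hopen := hx.stat
    rw [hv] at hopen
    obtain ⟨i, hi⟩ := hr.exists_opened hsat hopen
    have ho : T.Open (i.1 :: x) := .child x i hx i.2 hi
    obtain ⟨w, hw⟩ := ih i i.2 ho
    exact ⟨w, .head (.intro i hsat i.2 ho) hw⟩

/-- The Hintikka structure that is read off from an open tableau. -/
def lstruct (T : NodeTree) (h : Nonempty T.World) : LStruct T.World where
  nonempty := h
  -- The node `y` need not be a child of `w`: for a blocked diamond it is an ancestor with the right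
  -- formula set. H5 holds by this definition.
  R a w v := ∃ χ y, Fml.dia (.atom a) χ ∈ T.fmls w ∧ T.Open y ∧
    T.fmls y = insert χ (boxArgs a (T.fmls w)) ∧ T.Segment y v
  L w := {χ | ∃ y, T.Open y ∧ T.Segment y w ∧ χ ∈ T.fmls y}

theorem mem_L_of_segment {h : Nonempty T.World} {w : T.World} {y : List ℕ} (hy : T.Open y)
    (hs : T.Segment y w) {χ : Fml} (hχ : χ ∈ T.fmls y) : χ ∈ (T.lstruct h).L w :=
  ⟨y, hy, hs, hχ⟩

theorem IsComplete.mem_fmls_of_mem_L (hT : T.IsComplete) {h : Nonempty T.World} {w : T.World}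
    {χ : Fml} (hs : χ.IsSimple) (hχ : χ ∈ (T.lstruct h).L w) : χ ∈ T.fmls w := by
  obtain ⟨y, hy, hyw, hm⟩ := hχ
  exact Segment.simple hT hy hyw hs hm

theorem IsComplete.diaStep (hT : T.IsComplete) (w : T.World) :
    ∃ c, (∀ i : Fin (T.arity w), (T.label (i.val :: w.1)).seq = c i) ∧
      DiaStep (T.label w).seq (T.label w).vars c (fun i => (T.label (i.val :: w.1)).vars) := by
  obtain ⟨c, act, hr, hc, hv⟩ := hT.rule w w.2.1.mem
  have hopen := w.2.1.stat
  rw [hv] at hopen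
  exact ⟨c, hc, hv ▸ hr.diaStep w.2.2 hopen⟩

/-- Each entry of `HCr` stems from an open ancestor whose eventualities are
postponed at most to smaller levels. -/
theorem IsComplete.exists_core (hT : T.IsComplete) {x : List ℕ} (hx : T.Open x) {j : ℕ}
    {e : Fml × Set Fml} (he : (T.label x).seq.HCr[j]? = some e) :
    ∃ y, T.Open y ∧ T.fmls y = e.2 ∧ e.1 ∈ e.2 ∧ ∀ ψ ∈ FmlDiaStar, e.1 ∈ pre ψ →
      ∀ m, (T.label y).vars.uev e.1 ψ = some m → (m : ℕ) ≤ j := by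
  induction hx with
  | root => simp [hT.hcr_root] at he
  | child x i hx hi hst ih =>
    by_cases hsat : Saturated (T.fmls x)
    · obtain ⟨c, hc, hd⟩ := hT.diaStep ⟨x, hx, hsat⟩
      obtain ⟨-, a, χ, hχ, hci, hb⟩ := hd.child ⟨i, hi⟩
      rw [← hc ⟨i, hi⟩] at hci
      dsimp only at hci
      rw [hci, coreSequent, List.getElem?_append] at he
      split at he
      · exact ih he
      · obtain ⟨h₁, rfl⟩ := List.getElem?_eq_some_iff.1 he
        simp only [List.length_singleton, Nat.lt_one_iff] at h₁
        -- The new entry has position `j`, counted from 0, hence level `j + 1`; openness of the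
        -- parent bounds the value at the child by the old length `j`.
        have hj : j = (T.label x).seq.HCr.length := by omega
        simp only [List.getElem_singleton, corePair]
        refine ⟨i :: x, .child x i hx hi hst, ?_, .inl rfl, ?_⟩
        · rw [fmls, hci]; rfl
        · rw [hj]; exact hb
    · refine ih ?_
      rwa [(hT.localStep hx (.intro i hsat hi (.child x i hx hi hst))).hcr] at he

/-- Every atomic diamond of a world has an open successor node that is recorded in some `HCr`. -/
theorem IsComplete.exists_entry (hT : T.IsComplete) (w : T.World) {a : ℕ} {χ : Fml}
    (hχ : Fml.dia (.atom a) χ ∈ T.fmls w) :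
    ∃ x, T.Open x ∧ ∃ j : ℕ, (T.label x).seq.HCr[j]? = some (corePair (T.fmls w) a χ) := by
  obtain ⟨c, hc, hd⟩ := hT.diaStep w
  rcases hd.dia a χ hχ with ⟨i, hci, -⟩ | ⟨j, hj, -⟩
  · refine ⟨_, .child w i w.2.1 i.2 (hd.child i).1, (T.label w).seq.HCr.length, ?_⟩
    rw [hc i, hci, coreSequent]
    simp [fmls]
  · exact ⟨w, w.2.1, j, hj⟩

/-- `BB` is emptied by the existential rule, so a formula in it entered on the current segment, and
its components were added at that moment. -/
theorem IsComplete.bb (hT : T.IsComplete) {x : List ℕ} (hx : T.Open x) {χ : Fml}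
    (hχ : χ ∈ (T.label x).seq.BB) {S : Set Fml} (hS : Alpha χ S) :
    ∀ ξ ∈ S, ∃ y, T.Open y ∧ T.Segment y x ∧ ξ ∈ T.fmls y := by
  induction hx with
  | root => simp [hT.bb_root] at hχ
  | child x i hx hi hst ih =>
    have hy : T.Open (i :: x) := .child x i hx hi hst
    by_cases hsat : Saturated (T.fmls x)
    · obtain ⟨c, hc, hd⟩ := hT.diaStep ⟨x, hx, hsat⟩
      obtain ⟨-, a, χ, -, hci, -⟩ := hd.child ⟨i, hi⟩
      rw [← hc ⟨i, hi⟩] at hci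
      dsimp only at hci
      rw [hci] at hχ
      exact absurd hχ (Set.notMem_empty _)
    · have hl : T.Local x (i :: x) := .intro i hsat hi hy
      intro ξ hξ
      rcases (hT.localStep hx hl).bb χ hχ with h | h
      · obtain ⟨y, h₁, h₂, h₃⟩ := ih h ξ hξ
        exact ⟨y, h₁, h₂.tail hl, h₃⟩
      · exact ⟨_, hy, .refl, h S hS hξ⟩

theorem IsComplete.alpha (hT : T.IsComplete) (hW : Nonempty T.World) (w : T.World) {χ : Fml}
    {S : Set Fml} (hS : Alpha χ S) (hχ : χ ∈ (T.lstruct hW).L w) : S ⊆ (T.lstruct hW).L w := by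
  obtain ⟨y, hy, hyw, hm⟩ := hχ
  induction hyw using Relation.ReflTransGen.head_induction_on with
  | refl =>
    have := w.2.2 χ hm
    cases hS <;> simp [Fml.IsSimple] at this
  | head hyz hzw ih =>
    rcases (hT.localStep hy hyz).alpha χ hm with h | h
    · exact ih hyz.open h
    · rcases h S hS with h | ⟨h, -⟩
      · exact fun ξ hξ => ⟨_, hyz.open, hzw, h hξ⟩
      -- The formula was dropped because of `BB`; its components stand above `y` on a segment that
      -- extends to `w`.
      · intro ξ hξ
        obtain ⟨x, h₁, h₂, h₃⟩ := hT.bb hy h hS ξ hξ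
        exact ⟨x, h₁, h₂.trans (.head hyz hzw), h₃⟩

theorem IsComplete.beta (hT : T.IsComplete) (hW : Nonempty T.World) (w : T.World)
    {χ χ₁ χ₂ : Fml} (hβ : Beta χ χ₁ χ₂) (hχ : χ ∈ (T.lstruct hW).L w) :
    χ₁ ∈ (T.lstruct hW).L w ∨ χ₂ ∈ (T.lstruct hW).L w := by
  obtain ⟨y, hy, hyw, hm⟩ := hχ
  induction hyw using Relation.ReflTransGen.head_induction_on with
  | refl =>
    have := w.2.2 χ hm
    cases hβ <;> simp [Fml.IsSimple] at this
  | head hyz hzw ih =>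
    rcases (hT.localStep hy hyz).beta χ hm with h | h
    · exact ih hyz.open h
    · exact (h _ _ hβ).imp (⟨_, hyz.open, hzw, ·⟩) (⟨_, hyz.open, hzw, ·⟩)

theorem IsComplete.isPreHintikka (hT : T.IsComplete) (hW : Nonempty T.World) :
    (T.lstruct hW).IsPreHintikka where
  h1 w p hn hp := by
    obtain ⟨c, -, hd⟩ := hT.diaStep w
    exact hd.consistent p ⟨hT.mem_fmls_of_mem_L (.inl ⟨p, rfl⟩) hp,
      hT.mem_fmls_of_mem_L (.inr (.inl ⟨p, rfl⟩)) hn⟩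
  h2 w _ _ hS hχ := hT.alpha hW w hS hχ
  h3 w _ _ _ hβ hχ := hT.beta hW w hβ hχ
  h4 w a φ hφ := by
    have hm := hT.mem_fmls_of_mem_L (.inr (.inr (.inl ⟨a, φ, rfl⟩))) hφ
    -- Blocked and unblocked diamonds are treated alike: either way the pair is an entry of the
    -- `HCr` of an open node.
    obtain ⟨x, hx, j, hj⟩ := hT.exists_entry w hm
    obtain ⟨y, hy, hyΓ, hmem, -⟩ := hT.exists_core hx hj
    obtain ⟨v, hv⟩ := hT.exists_world hy
    exact ⟨v, ⟨φ, y, hm, hy, hyΓ, hv⟩, y, hy, hv, hyΓ ▸ hmem⟩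
  h5 w a φ hφ v := by
    rintro ⟨χ, y, -, hy, hyΓ, hv⟩
    have hm := hT.mem_fmls_of_mem_L (.inr (.inr (.inr ⟨a, φ, rfl⟩))) hφ
    exact ⟨y, hy, hv, hyΓ ▸ .inr hm⟩

end NodeTree

/-! ### Fulfilling chains -/

/-- One step of a fulfilling chain. -/
structure LStruct.ChainStep {W : Type} (H : LStruct W) (φ : Fml) (p q : W × Fml) : Prop where
  pre_left : p.2 ∈ pre φ
  label_left : p.2 ∈ H.L p.1
  ne : p.2 ≠ φ
  atom : ∀ a χ, p.2 = .dia (.atom a) χ → q.2 = χ ∧ H.R a p.1 q.1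
  reduce : (¬ ∃ a χ, p.2 = .dia (.atom a) χ) → Reduces p.2 q.2 ∧ p.1 = q.1

theorem LStruct.exists_isFulfillingChain {W : Type} {H : LStruct W} {φ : Fml} {β : Prg}
    {w v : W} (h : Relation.ReflTransGen (H.ChainStep φ) (w, .dia β φ) (v, φ))
    (hφ : φ ∈ H.L v) : ∃ n u ψ, H.IsFulfillingChain φ β w n u ψ := by
  suffices hs : ∀ p, Relation.ReflTransGen (H.ChainStep φ) p (v, φ) →
      ∃ (n : ℕ) (c : ℕ → W × Fml), c 0 = p ∧ (c n).2 = φ ∧ (c n).2 ∈ H.L (c n).1 ∧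
        ∀ i < n, H.ChainStep φ (c i) (c (i + 1)) by
    obtain ⟨n, c, h₀, hn, hl, hc⟩ := hs _ h
    refine ⟨n, fun i => (c i).1, fun i => (c i).2, fun i hi => ?_, fun i hi => ?_,
      by simp only [h₀], by simp only [h₀], hn, fun i hi => (hc i hi).ne,
      fun i hi => (hc i hi).atom, fun i hi => (hc i hi).reduce⟩
    · rcases hi.lt_or_eq with hi | rfl
      · exact (hc i hi).pre_left
      · simp only [hn]; exact self_mem_pre φ
    · rcases hi.lt_or_eq with hi | rfl
      · exact (hc i hi).label_left
      · exact hl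
  intro p hp
  induction hp using Relation.ReflTransGen.head_induction_on with
  | refl => exact ⟨0, fun _ => (v, φ), rfl, rfl, hφ, by simp⟩
  | @head p q hpq _ ih =>
    obtain ⟨n, c, h₀, hn, hl, hc⟩ := ih
    refine ⟨n + 1, fun i => Nat.casesOn i p c, rfl, hn, hl, fun i hi => ?_⟩
    cases i with
    | zero => rw [← h₀] at hpq; exact hpq
    | succ i => exact hc i (by omega)

theorem LStruct.ChainStep.of_reduces {W : Type} {H : LStruct W} {α : Prg} {φ χ χ' : Fml} {w : W}
    (hpre : χ ∈ pre (.dia α φ)) (hL : χ ∈ H.L w) (hr : Reduces χ χ') :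
    H.ChainStep φ (w, χ) (w, χ') where
  pre_left := pre_dia_subset _ _ hpre
  label_left := hL
  ne := ne_of_mem_pre_dia hpre
  atom a ξ h := by
    dsimp only at h
    subst h
    cases hr
  reduce _ := ⟨hr, rfl⟩

theorem LStruct.ChainStep.of_atom {W : Type} {H : LStruct W} {α : Prg} {φ χ : Fml} {a : ℕ}
    {w v : W} (hpre : .dia (.atom a) χ ∈ pre (.dia α φ)) (hL : .dia (.atom a) χ ∈ H.L w)
    (hR : H.R a w v) : H.ChainStep φ (w, .dia (.atom a) χ) (v, χ) where
  pre_left := pre_dia_subset _ _ hpre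
  label_left := hL
  ne := ne_of_mem_pre_dia hpre
  atom b ξ h := by
    simp only [Fml.dia.injEq, Prg.atom.injEq] at h
    obtain ⟨rfl, rfl⟩ := h
    exact ⟨rfl, hR⟩
  reduce h := absurd ⟨a, χ, rfl⟩ h

-- Condition H6

namespace NodeTree
variable {T : NodeTree}

/-- The eventuality `⟨α*⟩φ` is fulfilled from `(w, χ)`. -/
def Fulfils (T : NodeTree) (hW : Nonempty T.World) (φ : Fml) (w : T.World) (χ : Fml) : Prop :=
  ∃ v, φ ∈ (T.lstruct hW).L v ∧
    Relation.ReflTransGen ((T.lstruct hW).ChainStep φ) (w, χ) (v, φ)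

/-- The pursuit of `⟨α*⟩φ` from `(w, χ)` leads to a diamond that is blocked by the entry
of `HCr` with level `m`. -/
def Postpones (T : NodeTree) (hW : Nonempty T.World) (α : Prg) (φ : Fml) (w : T.World)
    (χ : Fml) (m : ℕ+) : Prop :=
  ∃ (v : T.World) (a : ℕ) (ξ : Fml), Fml.dia (.atom a) ξ ∈ T.fmls v ∧
    Fml.dia (.atom a) ξ ∈ pre (.dia (.star α) φ) ∧
    (T.label v).seq.HCr[m.natPred]? = some (corePair (T.fmls v) a ξ) ∧
    Relation.ReflTransGen ((T.lstruct hW).ChainStep φ) (w, χ) (v, .dia (.atom a) ξ)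

/-- The values of `uev` are correct. -/
theorem IsComplete.fulfils_or_postpones (hT : T.IsComplete) (hW : Nonempty T.World) (α : Prg)
    (φ : Fml) {x : List ℕ} (hx : T.Open x) {χ : Fml} (hχ : χ ∈ T.fmls x)
    (hpre : χ ∈ pre (.dia (.star α) φ)) :
    ∃ w : T.World, T.Segment x w ∧ (T.Fulfils hW φ w χ ∨
      ∃ m, (T.label x).vars.uev χ (.dia (.star α) φ) = some m ∧ T.Postpones hW α φ w χ m) := by
  refine hT.induction (fun x => T.Open x → ∀ χ ∈ T.fmls x, χ ∈ pre (.dia (.star α) φ) →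
    ∃ w : T.World, T.Segment x w ∧ (T.Fulfils hW φ w χ ∨
      ∃ m, (T.label x).vars.uev χ (.dia (.star α) φ) = some m ∧ T.Postpones hW α φ w χ m))
    ?_ x hx.mem hx χ hχ hpre
  clear hx hχ hpre χ x
  intro x hmem ih hx χ hχ hpre
  by_cases hsat : Saturated (T.fmls x)
  · let w : T.World := ⟨x, hx, hsat⟩
    obtain ⟨c, hc, hd⟩ := hT.diaStep w
    obtain ⟨β, ξ, rfl⟩ := exists_eq_dia_of_mem_pre hpre
    obtain ⟨a, rfl⟩ : ∃ a, β = .atom a := by simpa [Fml.IsSimple] using hsat _ hχ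
    refine ⟨w, .refl, ?_⟩
    rcases hd.dia a ξ hχ with ⟨i, hci, huev⟩ | ⟨j, hj, huev⟩
    · have ho : T.Open (i.1 :: x) := .child x i hx i.2 (hd.child i).1
      rw [← hc i] at hci
      have hΓ : T.fmls (i.1 :: x) = insert ξ (boxArgs a (T.fmls x)) := congrArg Sequent.Γ hci
      obtain ⟨v, hv, h⟩ := ih i i.2 ho ξ (hΓ ▸ .inl rfl) (mem_pre_of_dia_atom hpre)
      have hstep : (T.lstruct hW).ChainStep φ (w, .dia (.atom a) ξ) (v, ξ) :=
        .of_atom hpre ⟨x, hx, .refl, hχ⟩ ⟨ξ, _, hχ, ho, hΓ, hv⟩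
      rcases h with ⟨u, h₁, h₂⟩ | ⟨m, hm, u, b, θ, h₁, h₂, h₃, h₄⟩
      · exact .inl ⟨u, h₁, .head hstep h₂⟩
      · exact .inr ⟨m, (huev _ ⟨α, φ, rfl⟩ hpre).trans hm, u, b, θ, h₁, h₂, h₃, .head hstep h₄⟩
    -- A blocked diamond ends the pursuit within the tree; the shift by 1 turns the position into
    -- the level.
    · exact .inr ⟨j.succPNat, huev _ ⟨α, φ, rfl⟩ hpre, w, a, ξ, hχ, hpre,
        by rw [Nat.natPred_succPNat]; exact hj, .refl⟩
  · obtain ⟨c, act, hr, hc, hv⟩ := hT.rule x hmem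
    have hopen := hx.stat
    rw [hv] at hopen
    -- The world to be found is not prescribed, so the child that supplies the value of `uev` may be
    -- chosen.
    obtain ⟨i, hi, ht⟩ := hr.exists_tracks hsat hopen hχ hpre
    have ho : T.Open (i.1 :: x) := .child x i hx i.2 hi
    have hl : T.Local x (i.1 :: x) := .intro i hsat i.2 ho
    rw [← hv, ← hc i] at ht
    rcases ht with ⟨rfl, hφ⟩ | ⟨χ', hχ', hpre', hred, huev⟩
    · obtain ⟨w, hw⟩ := hT.exists_world ho
      exact ⟨w, .head hl hw, .inl ⟨w, ⟨_, ho, hw, hφ⟩,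
        .single (.of_reduces hpre ⟨x, hx, .head hl hw, hχ⟩ (.starStop α φ))⟩⟩
    · obtain ⟨w, hw, h⟩ := ih i i.2 ho χ' hχ' hpre'
      have hstep : Relation.ReflTransGen ((T.lstruct hW).ChainStep φ) (w, χ) (w, χ') := by
        rcases hred with rfl | hred
        · exact .refl
        · exact .single (.of_reduces hpre ⟨x, hx, .head hl hw, hχ⟩ hred)
      refine ⟨w, .head hl hw, ?_⟩
      rcases h with ⟨u, h₁, h₂⟩ | ⟨m, hm, u, b, θ, h₁, h₂, h₃, h₄⟩
      · exact .inl ⟨u, h₁, hstep.trans h₂⟩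
      · exact .inr ⟨m, huev.trans hm, u, b, θ, h₁, h₂, h₃, hstep.trans h₄⟩

/-- At the nodes that are recorded in some `HCr`, all eventualities can be fulfilled. -/
theorem IsComplete.exists_fulfils (hT : T.IsComplete) (hW : Nonempty T.World) {α : Prg}
    {φ : Fml} {x : List ℕ} (hx : T.Open x) {j : ℕ} {e : Fml × Set Fml}
    (he : (T.label x).seq.HCr[j]? = some e) (hpre : e.1 ∈ pre (.dia (.star α) φ)) :
    ∃ y, T.Open y ∧ T.fmls y = e.2 ∧ ∃ w : T.World, T.Segment y w ∧ T.Fulfils hW φ w e.1 := by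
  induction j using Nat.strong_induction_on generalizing x e with
  | _ j ih =>
    obtain ⟨y, hy, hyΓ, hmem, hb⟩ := hT.exists_core hx he
    obtain ⟨w, hw, h | ⟨m, hm, v, a, ξ, h₁, h₂, h₃, h₄⟩⟩ :=
      hT.fulfils_or_postpones hW α φ hy (hyΓ ▸ hmem) hpre
    · exact ⟨y, hy, hyΓ, w, hw, h⟩
    -- The level `m` is at most `j`, so its position `m - 1` is strictly smaller: the blocking entry
    -- precedes the one considered.
    · have hlt : m.natPred < j := by
        have h₅ := hb _ ⟨α, φ, rfl⟩ hpre m hm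
        have h₆ := m.natPred_add_one
        omega
      -- The induction hypothesis is used at `v`, in whose `HCr` the blocking entry stands, and `R`
      -- connects `v` to the world `u` below the node `z` for that entry.
      obtain ⟨z, hz, hzΓ, u, hu, t, h₅, h₆⟩ := ih _ hlt v.2.1 h₃ (mem_pre_of_dia_atom h₂)
      refine ⟨y, hy, hyΓ, w, hw, t, h₅, h₄.trans (.head ?_ h₆)⟩
      exact .of_atom h₂ ⟨v, v.2.1, .refl, h₁⟩ ⟨ξ, z, h₁, hz, hzΓ, hu⟩

/-- The branches leading to `w` are given and may be bad ones for this eventuality. The chain merely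
stays in `w` until it is fulfilled or meets an atomic diamond; only the successor world is chosen to
suit the eventuality. -/
theorem IsComplete.fulfils (hT : T.IsComplete) (hW : Nonempty T.World) {α : Prg} {φ : Fml}
    (w : T.World) {χ : Fml} (hχ : χ ∈ (T.lstruct hW).L w)
    (hpre : χ ∈ pre (.dia (.star α) φ)) : T.Fulfils hW φ w χ := by
  obtain ⟨y, hy, hyw, hm⟩ := hχ
  induction hyw using Relation.ReflTransGen.head_induction_on generalizing χ with
  | refl =>
    obtain ⟨β, ξ, rfl⟩ := exists_eq_dia_of_mem_pre hpre
    obtain ⟨a, rfl⟩ : ∃ a, β = .atom a := by simpa [Fml.IsSimple] using w.2.2 _ hm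
    obtain ⟨x, hx, j, hj⟩ := hT.exists_entry w hm
    obtain ⟨z, hz, hzΓ, u, hu, t, h₅, h₆⟩ :=
      hT.exists_fulfils hW hx hj (mem_pre_of_dia_atom hpre)
    exact ⟨t, h₅, .head (.of_atom hpre ⟨w, w.2.1, .refl, hm⟩ ⟨ξ, z, hm, hz, hzΓ, hu⟩) h₆⟩
  | head hyz hzw ih =>
    have hL := mem_L_of_segment (h := hW) hy (.head hyz hzw) hm
    rcases (hT.localStep hy hyz).follow hm hpre with ⟨rfl, hφ⟩ | ⟨χ', hχ', hpre', hred⟩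
    · exact ⟨w, ⟨_, hyz.open, hzw, hφ⟩, .single (.of_reduces hpre hL (.starStop α φ))⟩
    · obtain ⟨t, h₁, h₂⟩ := ih hpre' hyz.open hχ'
      rcases hred with rfl | hred
      · exact ⟨t, h₁, h₂⟩
      · exact ⟨t, h₁, .head (.of_reduces hpre hL hred) h₂⟩

end NodeTree

end PDL

theorem mainTheorem2 (φ : PDL.Fml) (hφ : φ.IsNNF) (T : PDL.NodeTree)
    (hT : T.IsTableau ⟨{φ}, [], none, ∅, ∅⟩) (hexp : T.IsExpanded)
    (hopen : (T.label []).vars.stat = PDL.Status.opened) :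
    ∃ (W : Type) (H : PDL.LStruct W), H.IsHintikkaFor φ := by
  have hc := hT.isComplete hφ hexp
  have hroot : T.Open [] := .root hopen
  obtain ⟨w, hw⟩ := hc.exists_world hroot
  have hW : Nonempty T.World := ⟨w⟩
  refine ⟨T.World, T.lstruct hW, ⟨hc.isPreHintikka hW, fun v α ψ hψ => ?_⟩, w, [], hroot, hw, ?_⟩
  · obtain ⟨u, hu, hchain⟩ := hc.fulfils hW v hψ (PDL.self_mem_pre _)
    exact PDL.LStruct.exists_isFulfillingChain hchain hu
  · rw [PDL.NodeTree.fmls, hT.root]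
    rfl
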